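/- **Setting.** For $s\in\mathbb R$ let $\omega_0^s=1$, $\omega_k^s=k^s$ ($k\ge1$), and let $\Omega^s$ be the Banach space of real sequences $x=(x_k)_{k\ge0}$ with $\|x\|_s=\sup_k|x_k|\omega_k^s<\infty$; $B_0(r)=\{x\in\Omega^s:\|x\|_s\le r\}$. Put $(x*y)_k=\sum_{k_1+k_2=k,\ k_i\in\mathbb Z}x_{|k_1|}y_{|k_2|}$. Let $s>1$, $s_L>0$ and $f=\mathcal L+N$, where $\mathcal L_k(x)=\lambda_kx_{k-1}+\mu_kx_k+\beta_kx_{k+1}$ ($k\ge1$), $\mathcal L_0(x)=\mu_0x_0+\beta_0x_1$, and $N(x)=\sigma\,(x*x)+g$ with $\sigma\in\mathbb R$ and a constant sequence $g$ with $g_k=0$ for $k\ge 2m-1$ ($m$ below; e.g. $g=0$). Assume there are $0<C_1\le C_2$, $\delta\in(0,\frac12)$, $k_0\ge0$ with $|\lambda_k|,|\mu_k|,|\beta_k|\le C_2\,\omega_k^{s_L}$ for all $k\ge0$, and $|\mu_k|\ge C_1\omega_k^{s_L}$, $|\lambda_k/\mu_k|\le\delta$, $|\beta_k/\mu_k|\le\delta$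 for all $k\ge k_0$. Let $m\ge6$, $m\ge k_0$, let $\bar x=(\bar x_0,\dots,\bar x_{m-1},0,0,\dots)$, and let $L\ge1$ be an integer. Write $x_F=(x_0,\dots,x_{m-1})$, $x_I=(x_m,x_{m+1},\dots)$; $|\cdot|$ of vectors and matrices is entrywise; for an $m\times m$ matrix $B$ (rows and columns numbered $0,\dots,m-1$), $B_{c_{m-1}}$ and $B_{r_{m-1}}$ are its last column and row. **The operator $A$.** Put $a_n=\lambda_{m+n-1}$, $b_n=\mu_{m+n-1}$, $c_n=\beta_{m+n-1}$, $\delta_0=1$, $\delta_1=b_1$, $\delta_n=b_n\delta_{n-1}-a_nc_{n-1}\delta_{n-2}$. The tridiagonal tail factors as $L_IU_I$ with $L_I$ unit lower bidiagonal with subdiagonal $a_{n+1}\delta_{n-1}/\delta_n$ and $U_I$ upper bidiagonal with diagonal $\delta_n/\delta_{n-1}$ and superdiagonal $c_n$ ($n\ge1$); for sequences indexed from $0$, $$(L_I^{-1}y)_k=y_k+\sum_{l=1}^k(-1)^la_{k-l+2}\cdots a_{k+1}\tfrac{\delta_{k-l}}{\delta_k}y_{k-l},\qquad (U_I^{-1}z)_k=\sum_{l\ge0}(-1)^l\tfrac{\delta_k}{\delta_{k+l+1}}c_{k+1}\cdots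 c_{k+l}\,z_{k+l}.$$ Let $\mathcal T^{-1}=U_I^{-1}L_I^{-1}$, $w=\mathcal T^{-1}(1,0,0,\dots)$ and $$\tilde w=\frac{\delta_0}{\delta_1}+\sum_{l=1}^{L-1}\frac{\delta_0^2}{\delta_l\delta_{l+1}}c_1\cdots c_l\,a_2\cdots a_{l+1}.$$ Let $D=Df^{(m)}(\bar x)$, where $f^{(m)}:\mathbb R^m\to\mathbb R^m$ is $u\mapsto (f(u,0,0,\dots))_F$; let $\tilde K$ be $D$ with $\beta_{m-1}\lambda_m\tilde w$ subtracted from its entry $(m-1,m-1)$; let $A_m$ be any real $m\times m$ matrix (in practice a numerical inverse of $\tilde K$). Define $A$ by $$(Ay)_F=A_my_F-\beta_{m-1}(\mathcal T^{-1}y_I)_0(A_m)_{c_{m-1}},$$ $$(Ay)_I=-\lambda_m\big((A_m)_{r_{m-1}}y_F\big)w+\mathcal T^{-1}y_I+\beta_{m-1}\lambda_m(A_m)_{m-1,m-1}(\mathcal T^{-1}y_I)_0\,w .$$ **Constants.** $\gamma=\frac12+\sqrt{\frac14-\delta^2}$, $\theta=\delta/\gamma$, $\eta=\frac1{\gamma(1-\theta^2)}$,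 $p=s+s_L$. Let $M$ be an integer with $M\ge m$, $M\ge4/(\ln\theta)^2$, $M\ge-\frac{s}{\ln\theta}-m$ and $$M\ge\frac{-m\ln\sqrt\theta-p-1-\sqrt{(m\ln\sqrt\theta+p+1)^2-4m\ln\sqrt\theta}}{2\ln\sqrt\theta}.$$ Let $$\chi=\theta^{M/2}\tfrac M2\big(\tfrac{m+M}m\big)^p+\theta^{\sqrt M}\tfrac M2 2^p+\tfrac1{1-\theta}\big(\tfrac{m+M}{m+M-\sqrt M-1}\big)^p .$$ With $\zeta_L=2\sum_{l=1}^Ll^{-s}+\frac{2}{(s-1)L^{s-1}}$ let $\alpha_0=1+\zeta_L$, $\alpha_k=2+\zeta_L+\sum_{l=1}^{k-1}\frac{k^s}{l^s(k-l)^s}$ for $1\le k<m$, and $$\alpha_m=\begin{cases}2+\zeta_L+2\big(\frac m{m-1}\big)^s+\big(\frac{4\ln(m-2)}m+\frac{\pi^2-6}3\big)\big(\frac2m+\frac12\big)^{s-2},&s\ge2,\\ 2+\zeta_L+2^{s-1}\zeta_L,&1<s<2.\end{cases}$$ **The vector $Y$.** With $q_l=|f(\bar x)_{m+l}|/|\mu_{m+l}|$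 and $S=\sum_{l=0}^{m-2}\theta^lq_l$: $Y_F=|A_mf(\bar x)_F|+|\beta_{m-1}|\eta S\,|(A_m)_{c_{m-1}}|$, and for $0\le k\le M$ $$Y_{m+k}=\Big(|(A_m)_{r_{m-1}}f(\bar x)_F|+|\beta_{m-1}(A_m)_{m-1,m-1}|\eta S\Big)\eta\theta^k\tfrac{|\lambda_m|}{|\mu_m|}+R_k,$$ with $R_k=\eta\sum_{l=0}^k\theta^{k-l}q_l+\eta\sum_{l=k+1}^{m-2}\theta^{l-k}q_l$ for $k\le m-3$ and $R_k=\eta\theta^k\sum_{l=0}^{m-2}\theta^{-l}q_l$ for $m-2\le k\le M$; and $Y_{m+k}=Y_{m+M}\,\omega_{m+M}^s/\omega_{m+k}^s$ for $k>M$. **The vector $Z(r)$.** $Z(r)=Z^1(r)+D^1r+D^2r^2$, where each of $Z^1,D^1,D^2$ is continued by $V_{m+k}=V_{m+M}\,\omega_{m+M}^s/\omega_{m+k}^s$ for $k>M$, and the other entries are as follows. With $W=(1/\omega_0^s,\dots,1/\omega_{m-1}^s)^T$ and $\varepsilon=\frac{|\beta_{m-1}||\lambda_m|\theta^{2L}}{|\mu_m|\,\omega_{m-1}^s(1-\theta^2)}$,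 $$Z^1_F=\big(|I-A_m\tilde K|W+\varepsilon|A_m|_{c_{m-1}}\big)r,\quad Z^1_{m+k}=\big(|I-A_m\tilde K|_{r_{m-1}}W+\varepsilon|A_m|_{m-1,m-1}\big)\eta\theta^k\tfrac{|\lambda_m|}{|\mu_m|}r\quad(0\le k\le M).$$ For $j=1,2$ let $\nu_1=\|\bar x\|_s$, $\nu_2=1$, $C^1_k=2|\sigma|\sum_{l=m-k}^{m-1}|\bar x_l|/\omega_{k+l}^s$ (so $C^1_0=0$), $C^2_k=2|\sigma|\alpha_k/\omega_k^s$ for $0\le k<m$, and $h_j=\frac{2|\beta_{m-1}|\eta|\sigma|\alpha_m\nu_j}{C_1(1-\theta)\omega_m^{p}}$. Then $$D^j_F=|A_m|C^j_F+h_j|A_m|_{c_{m-1}},$$ $$D^j_{m+k}=\big(|A_m|_{r_{m-1}}C^j_F+h_j|A_m|_{m-1,m-1}\big)\eta\tfrac{|\lambda_m|}{|\mu_m|}\theta^k+\frac{2\eta|\sigma|\alpha_m\nu_j}{C_1\omega_{m+k}^p}\Big(X_k+\frac\theta{1-\theta}\Big)\quad(0\le k\le M),$$ with $X_k=\sum_{l=0}^k\theta^{k-l}\big(\frac{m+k}{m+l}\big)^p$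 for $k<M$ and $X_M=\chi$. **Theorem.** Under these assumptions $T(x)=x-Af(x)$ is a well-defined Fréchet differentiable map $\Omega^s\to\Omega^s$, and for all $k\ge0$ $$|(T(\bar x)-\bar x)_k|\le Y_k,\qquad\text{and for all } r>0:\quad \sup_{b_1,b_2\in B_0(r)}\big|[DT(\bar x+b_1)b_2]_k\big|\le Z_k(r).$$ -/

import Mathlib

noncomputable section

namespace TridiagNewton

/-- The weights `ω_k^s`: `1` for `k = 0` and `k^s` for `k ≥ 1`. -/
def wt (s : ℝ) (k : ℕ) : ℝ := if k = 0 then 1 else (k : ℝ) ^ s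

theorem wt_pos (s : ℝ) (k : ℕ) : 0 < wt s k := by
  unfold wt
  split_ifs with h
  · exact one_pos
  · exact Real.rpow_pos_of_pos (by exact_mod_cast Nat.pos_of_ne_zero h) s

/-- The weighted sup-norm `‖x‖_s = sup_k |x_k| ω_k^s` of a sequence
(meaningful when the set of these values is bounded). -/
def seqNorm (s : ℝ) (x : ℕ → ℝ) : ℝ := ⨆ k, |x k| * wt s k

/-- `Ω^s` as a linear subspace of the space of all real sequences. -/
def omegaSubmodule (s : ℝ) : Submodule ℝ (ℕ → ℝ) where
  carrier := {x | BddAbove (Set.range fun k => |x k| * wt s k)}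
  zero_mem' := ⟨0, by rintro _ ⟨k, rfl⟩; simp⟩
  add_mem' := by
    rintro x y ⟨B, hB⟩ ⟨C, hC⟩
    refine ⟨B + C, ?_⟩
    rintro _ ⟨k, rfl⟩
    have h1 := hB ⟨k, rfl⟩
    have h2 := hC ⟨k, rfl⟩
    have h3 := mul_le_mul_of_nonneg_right (abs_add_le (x k) (y k)) (wt_pos s k).le
    simp only [Pi.add_apply] at *
    linarith
  smul_mem' := by
    rintro c x ⟨B, hB⟩
    refine ⟨|c| * B, ?_⟩
    rintro _ ⟨k, rfl⟩
    have h1 := mul_le_mul_of_nonneg_left (hB ⟨k, rfl⟩) (abs_nonneg c)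
    simp only [Pi.smul_apply, smul_eq_mul, abs_mul] at *
    linarith

/-- The Banach space `Ω^s`, whose topology is the one of the norm `‖·‖_s`
(not the one induced by the product `ℕ → ℝ`). -/
def Omega (s : ℝ) : Type := omegaSubmodule s

instance (s : ℝ) : AddCommGroup (Omega s) := inferInstanceAs (AddCommGroup (omegaSubmodule s))

instance (s : ℝ) : Module ℝ (Omega s) := inferInstanceAs (Module ℝ (omegaSubmodule s))

instance (s : ℝ) : CoeFun (Omega s) (fun _ => ℕ → ℝ) := ⟨fun x => x.1⟩

instance (s : ℝ) : Norm (Omega s) := ⟨fun x => seqNorm s x⟩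

theorem Omega.norm_def {s : ℝ} (x : Omega s) : ‖x‖ = ⨆ k, |x k| * wt s k := rfl

theorem Omega.le_norm {s : ℝ} (x : Omega s) (k : ℕ) : |x k| * wt s k ≤ ‖x‖ :=
  le_ciSup x.2 k

theorem Omega.normCore (s : ℝ) : NormedSpace.Core ℝ (Omega s) where
  norm_nonneg x := Real.iSup_nonneg fun k => mul_nonneg (abs_nonneg _) (wt_pos s k).le
  norm_smul c x := by
    rw [Omega.norm_def, Omega.norm_def, Real.norm_eq_abs, Real.mul_iSup_of_nonneg (abs_nonneg c)]
    congr 1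
    funext k
    have : (c • x) k = c * x k := rfl
    rw [this, abs_mul, mul_assoc]
  norm_triangle x y := by
    rw [Omega.norm_def (x + y)]
    refine ciSup_le fun k => ?_
    have h0 : (x + y) k = x k + y k := rfl
    have h1 := Omega.le_norm x k
    have h2 := Omega.le_norm y k
    have h3 := mul_le_mul_of_nonneg_right (abs_add_le (x k) (y k)) (wt_pos s k).le
    rw [h0]
    linarith
  norm_eq_zero_iff x := by
    constructor
    · intro h
      refine Subtype.ext (funext fun k => ?_)
      have h1 := Omega.le_norm x k
      rw [h] at h1
      have h2 := wt_pos s k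
      have h3 := abs_nonneg (x k)
      have h4 : |x k| = 0 := by nlinarith
      exact abs_eq_zero.mp h4
    · rintro rfl
      rw [Omega.norm_def]
      have : ∀ k, |(0 : Omega s) k| * wt s k = 0 := fun k => by
        have h : (0 : Omega s) k = 0 := rfl
        rw [h]; simp
      simp [this]

instance (s : ℝ) : NormedAddCommGroup (Omega s) := NormedAddCommGroup.ofCore (Omega.normCore s)

instance (s : ℝ) : NormedSpace ℝ (Omega s) := NormedSpace.ofCore (Omega.normCore s)

/-- Discrete convolution of the symmetric extensions `x̃_j = x_{|j|}`, `ỹ_j = y_{|j|}`. -/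
def conv (x y : ℕ → ℝ) (k : ℕ) : ℝ :=
  ∑' j : ℤ, x j.natAbs * y ((k : ℤ) - j).natAbs

/-- Extension of a finite vector by zero. -/
def extend {m : ℕ} (u : Fin m → ℝ) (k : ℕ) : ℝ := if h : k < m then u ⟨k, h⟩ else 0

theorem extend_mem (s : ℝ) {m : ℕ} (u : Fin m → ℝ) : extend u ∈ omegaSubmodule s := by
  refine ⟨∑ k ∈ Finset.range m, |extend u k| * wt s k, ?_⟩
  rintro _ ⟨k, rfl⟩
  have hnn : ∀ i ∈ Finset.range m, 0 ≤ |extend u i| * wt s i :=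
    fun i _ => mul_nonneg (abs_nonneg _) (wt_pos s i).le
  by_cases h : k < m
  · exact Finset.single_le_sum hnn (Finset.mem_range.mpr h)
  · have : extend u k = 0 := by simp [extend, h]
    simpa [this] using Finset.sum_nonneg hnn

/-- The finite part `x_F = (x_0, …, x_{m-1})`. -/
def finPart (m : ℕ) (x : ℕ → ℝ) : Fin m → ℝ := fun i => x i

/-- The infinite part `x_I = (x_m, x_{m+1}, …)`, re-indexed from `0`. -/
def infPart (m : ℕ) (x : ℕ → ℝ) : ℕ → ℝ := fun k => x (m + k)

/-- `2 ∑_{l=1}^{L} l^{-s} + 2 / ((s-1) L^{s-1})`. -/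
def zetaUp (s : ℝ) (L : ℕ) : ℝ :=
  2 * ∑ l ∈ Finset.Icc 1 L, 1 / (l : ℝ) ^ s + 2 / ((s - 1) * (L : ℝ) ^ (s - 1))

/-- The convolution constants `α_k^s(n)`, with computational parameter `L`. -/
def alpha (s : ℝ) (L n k : ℕ) : ℝ :=
  if k = 0 then 1 + zetaUp s L
  else if k < n then
    2 + zetaUp s L
      + ∑ l ∈ Finset.Icc 1 (k - 1), (k : ℝ) ^ s / ((l : ℝ) ^ s * ((k : ℝ) - (l : ℝ)) ^ s)
  else if 2 ≤ s then
    2 + zetaUp s L + 2 * ((n : ℝ) / ((n : ℝ) - 1)) ^ s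
      + (4 * Real.log ((n : ℝ) - 2) / (n : ℝ) + (Real.pi ^ 2 - 6) / 3)
        * (2 / (n : ℝ) + 1 / 2) ^ (s - 2)
  else 2 + zetaUp s L + (2 : ℝ) ^ (s - 1) * zetaUp s L

/-- The raw data: the exponents `s`, `s_L`, the constants `C₁`, `δ`, the three diagonals, the
nonlinearity `N(x) = σ (x * x) + g`, the numbers `m`, `M`, `L`, the finite approximate zero and the
matrix `A_m`. Apart from `0 < m`, needed to speak of the last row and column, nothing is assumed
of them here. -/
structure Data where
  s : ℝ
  sL : ℝ
  C₁ : ℝ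
  δ : ℝ
  lam : ℕ → ℝ
  mu : ℕ → ℝ
  beta : ℕ → ℝ
  σ : ℝ
  g : ℕ → ℝ
  m : ℕ
  m_pos : 0 < m
  M : ℕ
  L : ℕ
  xF : Fin m → ℝ
  Am : Matrix (Fin m) (Fin m) ℝ

namespace Data

variable (P : Data)

/-- The index `m - 1` of the last row and column. -/
def last : Fin P.m := ⟨P.m - 1, Nat.sub_lt P.m_pos one_pos⟩

/-- The tridiagonal operator `𝓛`. -/
def lin (x : ℕ → ℝ) : ℕ → ℝ
  | 0 => P.mu 0 * x 0 + P.beta 0 * x 1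
  | k + 1 => P.lam (k + 1) * x k + P.mu (k + 1) * x (k + 1) + P.beta (k + 1) * x (k + 2)

/-- The quadratic nonlinearity `N`. -/
def nonlin (x : ℕ → ℝ) (k : ℕ) : ℝ := P.σ * conv x x k + P.g k

/-- `f = 𝓛 + N`. -/
def f (x : ℕ → ℝ) (k : ℕ) : ℝ := P.lin x k + P.nonlin x k

/-- The approximate zero `x̄ = (x̄_0, …, x̄_{m-1}, 0, 0, …)`. -/
def xbar : ℕ → ℝ := extend P.xF

/-- `x̄` as a point of `Ω^s`. -/
def xbarOmega : Omega P.s := ⟨P.xbar, extend_mem P.s P.xF⟩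

/-- The finite dimensional projection `f^{(m)} : ℝ^m → ℝ^m`. -/
def fProj (u : Fin P.m → ℝ) : Fin P.m → ℝ := finPart P.m (P.f (extend u))

/-- The Jacobian matrix `D = Df^{(m)}(x̄)`. -/
def D : Matrix (Fin P.m) (Fin P.m) ℝ :=
  LinearMap.toMatrix' (fderiv ℝ P.fProj P.xF : (Fin P.m → ℝ) →ₗ[ℝ] (Fin P.m → ℝ))

/-! The tridiagonal tail and its LU factorisation. -/

/-- Sub-diagonal of the tail, `a_n = λ_{m+n-1}` for `n ≥ 2`. -/
def a (n : ℕ) : ℝ := P.lam (P.m + n - 1)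

/-- Diagonal of the tail, `b_n = μ_{m+n-1}` for `n ≥ 1`. -/
def b (n : ℕ) : ℝ := P.mu (P.m + n - 1)

/-- Super-diagonal of the tail, `c_n = β_{m+n-1}` for `n ≥ 1`. -/
def c (n : ℕ) : ℝ := P.beta (P.m + n - 1)

/-- The principal minors `δ_n`. -/
def minor : ℕ → ℝ
  | 0 => 1
  | 1 => P.b 1
  | n + 2 => P.b (n + 2) * minor (n + 1) - P.a (n + 2) * P.c (n + 1) * minor n

/-- `L_I⁻¹`, where `L_I` is unit lower bidiagonal with sub-diagonal
`a_2 δ_0/δ_1, a_3 δ_1/δ_2, …`. -/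
def LIinv (y : ℕ → ℝ) (k : ℕ) : ℝ :=
  y k + ∑ l ∈ Finset.Icc 1 k,
    (-1) ^ l * (∏ i ∈ Finset.Icc (k - l + 2) (k + 1), P.a i) * (P.minor (k - l) / P.minor k)
      * y (k - l)

/-- `U_I⁻¹`, where `U_I` is upper bidiagonal with diagonal `δ_1/δ_0, δ_2/δ_1, …` and
super-diagonal `c_1, c_2, …`. -/
def UIinv (z : ℕ → ℝ) (k : ℕ) : ℝ :=
  ∑' l : ℕ, (-1) ^ l * (P.minor k / P.minor (k + l + 1))
    * (∏ i ∈ Finset.Icc (k + 1) (k + l), P.c i) * z (k + l)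

/-- `U_I⁻¹ L_I⁻¹`. -/
def tailInv (y : ℕ → ℝ) : ℕ → ℝ := P.UIinv (P.LIinv y)

/-- `w_I = U_I⁻¹ L_I⁻¹ e₁`, with first entry `w_I 0`. -/
def wI : ℕ → ℝ := P.tailInv (Pi.single 0 1)

/-- The truncation `w̃` of the series for `(w_I)_0`. -/
def wTilde : ℝ :=
  P.minor 0 / P.minor 1 + ∑ l ∈ Finset.Icc 1 (P.L - 1),
    P.minor 0 ^ 2 / (P.minor l * P.minor (l + 1))
      * (∏ i ∈ Finset.Icc 1 l, P.c i) * (∏ i ∈ Finset.Icc 2 (l + 1), P.a i)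

/-- `K̃`: the matrix `D` with `β_{m-1} λ_m w̃` subtracted from its last diagonal entry. -/
def KTilde : Matrix (Fin P.m) (Fin P.m) ℝ :=
  P.D - (P.beta (P.m - 1) * P.lam P.m) • Matrix.single P.last P.last P.wTilde

/-- The approximate inverse `A`, acting on a sequence `y`. -/
def A (y : ℕ → ℝ) (k : ℕ) : ℝ :=
  if h : k < P.m then
    P.Am.mulVec (finPart P.m y) ⟨k, h⟩
      - P.beta (P.m - 1) * P.tailInv (infPart P.m y) 0 * P.Am ⟨k, h⟩ P.last
  else
    -P.lam P.m * P.Am.mulVec (finPart P.m y) P.last * P.wI (k - P.m)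
      + P.tailInv (infPart P.m y) (k - P.m)
      + P.beta (P.m - 1) * P.lam P.m * P.Am P.last P.last
        * P.tailInv (infPart P.m y) 0 * P.wI (k - P.m)

/-! Constants. -/

def γ : ℝ := 1 / 2 + Real.sqrt (1 / 4 - P.δ ^ 2)

def θ : ℝ := P.δ / P.γ

def η : ℝ := 1 / (P.γ * (1 - P.θ ^ 2))

def χ : ℝ :=
  P.θ ^ ((P.M : ℝ) / 2) * ((P.M : ℝ) / 2) * (((P.m : ℝ) + P.M) / P.m) ^ (P.s + P.sL)
    + P.θ ^ Real.sqrt P.M * ((P.M : ℝ) / 2) * (2 : ℝ) ^ (P.s + P.sL)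
    + 1 / (1 - P.θ)
      * (((P.m : ℝ) + P.M) / ((P.m : ℝ) + P.M - Real.sqrt P.M - 1)) ^ (P.s + P.sL)

/-- The first lower bound on the computational parameter `M`. -/
def CondMA : Prop :=
  max (max
    ((-(P.m : ℝ) * Real.log (Real.sqrt P.θ) - P.s - P.sL - 1
        - Real.sqrt (((P.m : ℝ) * Real.log (Real.sqrt P.θ) + P.s + P.sL + 1) ^ 2
            - 4 * (P.m : ℝ) * Real.log (Real.sqrt P.θ)))
      / (2 * Real.log (Real.sqrt P.θ)))
    (4 / Real.log P.θ ^ 2)) (P.m : ℝ) ≤ (P.M : ℝ)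

/-- The second lower bound on the computational parameter `M`. -/
def CondMY : Prop :=
  max (-P.s / Real.log P.θ - (P.m : ℝ)) ((P.m : ℝ) - 2) ≤ (P.M : ℝ)

/-- A vector with entries `u_k` for `k < m`, `v_j` for `k = m + j`, `0 ≤ j ≤ M`, and
`v_M ω_{m+M}^s / ω_k^s` for `k > m + M`. -/
def glue (u : Fin P.m → ℝ) (v : ℕ → ℝ) (k : ℕ) : ℝ :=
  if h : k < P.m then u ⟨k, h⟩
  else if k ≤ P.m + P.M then v (k - P.m)
  else v P.M * wt P.s (P.m + P.M) / wt P.s k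

/-! The bound `Y`. -/

/-- `|f(x̄)|_{m+l} / |μ_{m+l}|`. -/
def q (l : ℕ) : ℝ := |P.f P.xbar (P.m + l)| / |P.mu (P.m + l)|

/-- `∑_{l=0}^{m-2} θ^l |f(x̄)|_{m+l} / |μ_{m+l}|`. -/
def S : ℝ := ∑ l ∈ Finset.Icc 0 (P.m - 2), P.θ ^ l * P.q l

def YF (i : Fin P.m) : ℝ :=
  |P.Am.mulVec (finPart P.m (P.f P.xbar)) i|
    + |P.beta (P.m - 1)| * P.η * P.S * |P.Am i P.last|

def YI (k : ℕ) : ℝ :=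
  (|P.Am.mulVec (finPart P.m (P.f P.xbar)) P.last|
      + |P.beta (P.m - 1) * P.Am P.last P.last| * P.η * P.S)
    * P.η * P.θ ^ k * (|P.lam P.m| / |P.mu P.m|)
  + (if k + 3 ≤ P.m then
      P.η * ∑ l ∈ Finset.Icc 0 k, P.θ ^ (k - l) * P.q l
        + P.η * ∑ l ∈ Finset.Icc (k + 1) (P.m - 2), P.θ ^ (l - k) * P.q l
    else
      P.η * P.θ ^ k * ∑ l ∈ Finset.Icc 0 (P.m - 2), P.q l / P.θ ^ l)

def Y : ℕ → ℝ := P.glue P.YF P.YI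

/-! The bound `Z(r) = Z¹(r) + Z²(r)`. -/

/-- `W_F^s = (1/ω_0^s, …, 1/ω_{m-1}^s)`. -/
def WF (i : Fin P.m) : ℝ := 1 / wt P.s i

/-- `|I - A_m K̃|`, entrywise. -/
def absDefect : Matrix (Fin P.m) (Fin P.m) ℝ := (1 - P.Am * P.KTilde).map abs

/-- `|A_m|`, entrywise. -/
def absAm : Matrix (Fin P.m) (Fin P.m) ℝ := P.Am.map abs

/-- `|β_{m-1}| |λ_m| θ^{2L} / (|μ_m| ω_{m-1}^s (1 - θ²))`. -/
def ε : ℝ :=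
  |P.beta (P.m - 1)| * |P.lam P.m| * P.θ ^ (2 * P.L)
    / (|P.mu P.m| * wt P.s (P.m - 1) * (1 - P.θ ^ 2))

def Z1F (r : ℝ) (i : Fin P.m) : ℝ :=
  (P.absDefect.mulVec P.WF i + P.ε * P.absAm i P.last) * r

def Z1I (r : ℝ) (k : ℕ) : ℝ :=
  (P.absDefect.mulVec P.WF P.last + P.ε * P.absAm P.last P.last)
    * P.η * P.θ ^ k * (|P.lam P.m| / |P.mu P.m|) * r

def Z1 (r : ℝ) : ℕ → ℝ := P.glue (P.Z1F r) (P.Z1I r)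

/-- `α_m^s(m)`. -/
def αm : ℝ := alpha P.s P.L P.m P.m

/-- The finite part of `C¹(x̄)`; the sum is empty for `k = 0`. -/
def C1F (k : Fin P.m) : ℝ :=
  2 * |P.σ| * ∑ l ∈ Finset.Icc (P.m - k) (P.m - 1), |P.xbar l| / wt P.s (k + l)

/-- The finite part of `C²`. -/
def C2F (k : Fin P.m) : ℝ := 2 * |P.σ| * alpha P.s P.L P.m k / wt P.s k

/-- Common form of the finite parts of `D¹` and `D²`, where `C` is the finite part and
`2 |σ| α_m^s(m) ν / ω_k^s`, `k ≥ m`, the tail of `C¹` (`ν = ‖x̄‖_s`) or `C²` (`ν = 1`). -/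
def DF (C : Fin P.m → ℝ) (ν : ℝ) (i : Fin P.m) : ℝ :=
  P.absAm.mulVec C i
    + 2 * |P.beta (P.m - 1)| * P.η * |P.σ| * P.αm * ν
        / (P.C₁ * (1 - P.θ) * wt (P.s + P.sL) P.m) * P.absAm i P.last

/-- Common form of the entries of `D¹` and `D²` of index `m + k`, `0 ≤ k ≤ M`. -/
def DI (C : Fin P.m → ℝ) (ν : ℝ) (k : ℕ) : ℝ :=
  (P.absAm.mulVec C P.last
      + 2 * |P.beta (P.m - 1)| * P.absAm P.last P.last * P.η * |P.σ| * P.αm * ν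
          / (P.C₁ * (1 - P.θ) * wt (P.s + P.sL) P.m))
    * P.η * (|P.lam P.m| / |P.mu P.m|) * P.θ ^ k
  + 2 * P.η * |P.σ| * P.αm * ν / (P.C₁ * wt (P.s + P.sL) (P.m + k))
    * ((if k < P.M then
          ∑ l ∈ Finset.Icc 0 k,
            P.θ ^ (k - l) * (((P.m : ℝ) + k) / ((P.m : ℝ) + l)) ^ (P.s + P.sL)
        else P.χ)
      + P.θ / (1 - P.θ))

def D1 : ℕ → ℝ :=
  P.glue (P.DF P.C1F (seqNorm P.s P.xbar)) (P.DI P.C1F (seqNorm P.s P.xbar))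

def D2 : ℕ → ℝ := P.glue (P.DF P.C2F 1) (P.DI P.C2F 1)

def Z2 (r : ℝ) (k : ℕ) : ℝ := P.D1 k * r + P.D2 k * r ^ 2

def Z (r : ℝ) (k : ℕ) : ℝ := P.Z1 r k + P.Z2 r k

end Data

end TridiagNewton

end

/-!
`T x̄ - x̄ = -A f(x̄)`, and with `A†` the operator that is `D` on the finite part and `𝓛` on the
tail,

  `DT(x̄ + b₁) b₂ = (I - A A†) b₂ - A (Df(x̄ + b₁) b₂ - A† b₂)`.

Since the tail is tridiagonal and diagonally dominant, the ratios `δ_{n-1}/δ_n` of its principal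
minors are at most `1/(γ |b_n|)`, so that the entries of `𝓣⁻¹` decay geometrically away from the
diagonal: `|(𝓣⁻¹ y)_k| ≤ η ∑_j θ^|k-j| |y_j / b_{j+1}|`. This bounds `A f(x̄)` by `Y`, because
`f(x̄)` has finitely many non-zero entries. As `𝓣⁻¹` inverts the tail of `𝓛`, the operator
`I - A A†` only retains the errors of `A_m` as an inverse of `K̃` and of `w̃` as an
approximation of `w_0`, which give `Z¹`. What is left of `Df(x̄ + b₁) b₂` is
`2σ (x̄ * b₂ + b₁ * b₂)` without the part of `x̄ * b₂` contained in `D`; the convolution estimate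
`|(x * y)_k| ≤ α_k ‖x‖ ‖y‖ / ω_k^s` bounds it, and the decay of `𝓣⁻¹` then gives the terms in `D¹`
and `D²`. Beyond the index `m + M` the bounds compare powers of `θ` with powers of `k`.
-/

noncomputable section

namespace TridiagNewton

/-! ### Weights -/

theorem wt_of_ne_zero (s : ℝ) {k : ℕ} (hk : k ≠ 0) : wt s k = (k : ℝ) ^ s := if_neg hk

@[simp]
theorem wt_zero_right (s : ℝ) : wt s 0 = 1 := if_pos rfl

theorem wt_add (s t : ℝ) (k : ℕ) : wt (s + t) k = wt s k * wt t k := by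
  rcases eq_or_ne k 0 with rfl | hk
  · simp
  · simp only [wt_of_ne_zero _ hk]
    exact Real.rpow_add (by positivity) s t

theorem wt_mono {s : ℝ} (hs : 0 ≤ s) : Monotone (wt s) := by
  intro j k hjk
  rcases eq_or_ne k 0 with rfl | hk
  · rw [Nat.le_zero.1 hjk]
  rw [wt_of_ne_zero s hk]
  rcases eq_or_ne j 0 with rfl | hj
  · rw [wt_zero_right]
    exact Real.one_le_rpow (by exact_mod_cast Nat.one_le_iff_ne_zero.2 hk) hs
  · rw [wt_of_ne_zero s hj]
    exact Real.rpow_le_rpow (by positivity) (by exact_mod_cast hjk) hs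

theorem wt_exponent_mono (k : ℕ) : Monotone fun s => wt s k := by
  intro s t hst
  rcases eq_or_ne k 0 with rfl | hk
  · simp
  · simp only [wt_of_ne_zero _ hk]
    exact Real.rpow_le_rpow_of_exponent_le
      (by exact_mod_cast Nat.one_le_iff_ne_zero.2 hk) hst

theorem one_le_wt {s : ℝ} (hs : 0 ≤ s) (k : ℕ) : 1 ≤ wt s k := by
  simpa using wt_mono hs (Nat.zero_le k)

theorem wt_succ_le {s : ℝ} (hs : 0 ≤ s) (k : ℕ) : wt s (k + 1) ≤ 2 ^ s * wt s k := by
  rw [wt_of_ne_zero s k.succ_ne_zero]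
  rcases eq_or_ne k 0 with rfl | hk
  · simpa using Real.one_le_rpow one_le_two hs
  · rw [wt_of_ne_zero s hk, ← Real.mul_rpow zero_le_two k.cast_nonneg]
    have : (1 : ℝ) ≤ k := by exact_mod_cast Nat.one_le_iff_ne_zero.2 hk
    refine Real.rpow_le_rpow (by positivity) ?_ hs
    push_cast
    linarith

theorem wt_div_wt (p : ℝ) {j k : ℕ} (hj : j ≠ 0) (hk : k ≠ 0) :
    wt p k / wt p j = ((k : ℝ) / j) ^ p := by
  rw [wt_of_ne_zero p hj, wt_of_ne_zero p hk, Real.div_rpow (by positivity) (by positivity)]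

theorem Omega.abs_le {s : ℝ} (x : Omega s) (k : ℕ) : |x k| ≤ ‖x‖ / wt s k :=
  (le_div_iff₀ (wt_pos s k)).2 (x.le_norm k)

theorem Omega.norm_le {s : ℝ} (x : Omega s) {C : ℝ} (h : ∀ k, |x k| * wt s k ≤ C) : ‖x‖ ≤ C :=
  ciSup_le h

/-! ### One-sided and two-sided geometric sums -/

/-- The causal convolution `∑_{j ≤ k} θ^{k-j} q_j` with the geometric sequence, which bounds the
inverse of a lower bidiagonal operator. -/
def geomConv (θ : ℝ) (q : ℕ → ℝ) (k : ℕ) : ℝ :=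
  ∑ j ∈ Finset.range (k + 1), θ ^ (k - j) * q j

/-- The two-sided sum `∑_j θ^{|k-j|} q_j`, which bounds the inverse of a tridiagonal operator. The
terms `j < k` and `j ≥ k` are separated so that no absolute value of indices is needed. -/
def greenSum (θ : ℝ) (q : ℕ → ℝ) (k : ℕ) : ℝ :=
  ∑ j ∈ Finset.range k, θ ^ (k - j) * q j + ∑' i, θ ^ i * q (k + i)

@[simp]
theorem geomConv_zero (θ : ℝ) (q : ℕ → ℝ) : geomConv θ q 0 = q 0 := by simp [geomConv]

theorem geomConv_succ (θ : ℝ) (q : ℕ → ℝ) (k : ℕ) :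
    geomConv θ q (k + 1) = q (k + 1) + θ * geomConv θ q k := by
  rw [geomConv, Finset.sum_range_succ, geomConv, Finset.mul_sum, add_comm, Nat.sub_self, pow_zero,
    one_mul]
  congr 1
  refine Finset.sum_congr rfl fun j hj => ?_
  rw [Nat.succ_sub (Nat.lt_succ_iff.1 (Finset.mem_range.1 hj)), pow_succ']
  ring

section

variable {θ : ℝ} (h0 : 0 ≤ θ) (h1 : θ < 1)
include h0 h1

theorem summable_norm_pow_mul {q : ℕ → ℝ} {B : ℝ} (hq : ∀ j, |q j| ≤ B) :
    Summable fun i => ‖θ ^ i * q i‖ := by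
  refine Summable.of_nonneg_of_le (fun i => norm_nonneg _) (fun i => ?_)
    ((summable_geometric_of_lt_one h0 h1).mul_right B)
  rw [norm_mul, Real.norm_eq_abs, Real.norm_eq_abs, abs_of_nonneg (pow_nonneg h0 i)]
  exact mul_le_mul_of_nonneg_left (hq i) (pow_nonneg h0 i)

theorem hasSum_pow_mul_geomConv {q : ℕ → ℝ} {B : ℝ} (hq : ∀ j, |q j| ≤ B) (k : ℕ) :
    HasSum (fun l => θ ^ l * geomConv θ q (k + l)) (greenSum θ q k / (1 - θ ^ 2)) := by
  have hgeo := hasSum_geometric_of_lt_one (sq_nonneg θ) (pow_lt_one₀ h0 h1 two_ne_zero)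
  have hcauchy := hasSum_sum_range_mul_of_summable_norm
    (summable_norm_pow_mul h0 h1 fun i => hq (k + i)) hgeo.summable.norm
  have hsum := (hgeo.mul_left (∑ j ∈ Finset.range k, θ ^ (k - j) * q j)).add hcauchy
  rw [hgeo.tsum_eq, ← add_mul, ← div_eq_mul_inv] at hsum
  refine hsum.congr_fun fun l => ?_
  rw [geomConv, add_assoc, Finset.sum_range_add, mul_add, Finset.mul_sum, Finset.sum_mul,
    Finset.mul_sum]
  congr 1
  · refine Finset.sum_congr rfl fun j hj => ?_
    rw [show k + l - j = (k - j) + l by have := Finset.mem_range.1 hj; omega, pow_add]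
    ring
  · refine Finset.sum_congr rfl fun i hi => ?_
    obtain ⟨n, rfl⟩ := Nat.exists_eq_add_of_le (Nat.lt_succ_iff.1 (Finset.mem_range.1 hi))
    rw [show k + (i + n) - (k + i) = n by omega, Nat.add_sub_cancel_left, pow_add, ← pow_mul]
    ring

theorem greenSum_mono {q q' : ℕ → ℝ} {B : ℝ} (hq : ∀ j, 0 ≤ q j) (hqq' : ∀ j, q j ≤ q' j)
    (hB : ∀ j, q' j ≤ B) (k : ℕ) : greenSum θ q k ≤ greenSum θ q' k := by
  have habs : ∀ j, |q j| ≤ B := fun j => by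
    rw [abs_of_nonneg (hq j)]; exact (hqq' j).trans (hB j)
  have habs' : ∀ j, |q' j| ≤ B := fun j => by
    rw [abs_of_nonneg ((hq j).trans (hqq' j))]; exact hB j
  have hterm : ∀ n j, θ ^ n * q j ≤ θ ^ n * q' j := fun n j =>
    mul_le_mul_of_nonneg_left (hqq' j) (pow_nonneg h0 n)
  exact add_le_add (Finset.sum_le_sum fun j _ => hterm _ j) <|
    Summable.tsum_le_tsum (fun i => hterm i _)
      (summable_norm_pow_mul h0 h1 fun i => habs (k + i)).of_norm
      (summable_norm_pow_mul h0 h1 fun i => habs' (k + i)).of_norm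

end

theorem greenSum_const_mul (θ : ℝ) (q : ℕ → ℝ) (c : ℝ) (k : ℕ) :
    greenSum θ (fun j => c * q j) k = c * greenSum θ q k := by
  unfold greenSum
  rw [mul_add, Finset.mul_sum, ← tsum_mul_left]
  simp only [mul_left_comm]

theorem greenSum_single (θ c : ℝ) (k : ℕ) : greenSum θ (Pi.single 0 c) k = θ ^ k * c := by
  unfold greenSum
  rcases k with _ | k
  · rw [tsum_eq_single 0 fun i hi => by simp [hi]]
    simp
  · simp [Pi.single_apply]

namespace Data

variable {P : Data}

/-! ### The constants `γ`, `θ`, `η` -/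

/-- The range of the off-diagonal ratio `δ` in which `γ` is real and `θ < 1`. -/
structure SmallRatio (P : Data) : Prop where
  δ_pos : 0 < P.δ
  δ_lt_half : P.δ < 1 / 2

/-- Strict diagonal dominance of the tail of the tridiagonal operator with ratio `δ`. This is all
that the LU factorisation of the tail needs. -/
structure TailDominant (P : Data) : Prop extends SmallRatio P where
  mu_ne_zero : ∀ k, P.m ≤ k → P.mu k ≠ 0
  abs_lam_le_mu : ∀ k, P.m ≤ k → |P.lam k| ≤ P.δ * |P.mu k|
  abs_beta_le_mu : ∀ k, P.m ≤ k → |P.beta k| ≤ P.δ * |P.mu k|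

namespace SmallRatio

variable (H : P.SmallRatio)
include H

theorem half_lt_γ : 1 / 2 < P.γ :=
  lt_add_of_pos_right _ (Real.sqrt_pos.2 (by nlinarith [H.δ_pos, H.δ_lt_half]))

theorem γ_pos : 0 < P.γ := one_half_pos.trans H.half_lt_γ

theorem γ_sq : P.γ ^ 2 = P.γ - P.δ ^ 2 := by
  have hsqrt := Real.sq_sqrt (show 0 ≤ 1 / 4 - P.δ ^ 2 by nlinarith [H.δ_pos, H.δ_lt_half])
  unfold Data.γ
  linear_combination hsqrt

theorem θ_pos : 0 < P.θ := div_pos H.δ_pos H.γ_pos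

theorem θ_lt_one : P.θ < 1 := (div_lt_one H.γ_pos).2 (H.δ_lt_half.trans H.half_lt_γ)

theorem one_sub_θ_pos : 0 < 1 - P.θ := sub_pos.2 H.θ_lt_one

theorem θ_sq_lt_one : P.θ ^ 2 < 1 := pow_lt_one₀ H.θ_pos.le H.θ_lt_one two_ne_zero

theorem θ_mul_γ : P.θ * P.γ = P.δ := div_mul_cancel₀ _ H.γ_pos.ne'

theorem γ_eq_one_sub : P.γ = 1 - P.δ * P.θ := by
  refine mul_right_cancel₀ H.γ_pos.ne' ?_
  linear_combination H.γ_sq + P.δ * H.θ_mul_γ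

theorem γ_le_one : P.γ ≤ 1 := by
  rw [H.γ_eq_one_sub]
  exact sub_le_self _ (mul_pos H.δ_pos H.θ_pos).le

theorem η_pos : 0 < P.η := one_div_pos.2 (mul_pos H.γ_pos (sub_pos.2 H.θ_sq_lt_one))

end SmallRatio

/-! ### Pivots of the LU factorisation of the tail -/

/-- The pivots of the LU factorisation of the tridiagonal tail: the diagonal entries
`δ_{k+1} / δ_k` of `U_I`. -/
def pivot (P : Data) (k : ℕ) : ℝ := P.minor (k + 1) / P.minor k

@[simp]
theorem pivot_zero (P : Data) : P.pivot 0 = P.b 1 := div_one _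

theorem pivot_succ {n : ℕ} (h : P.minor (n + 1) ≠ 0) :
    P.pivot (n + 1) = P.b (n + 2) - P.a (n + 2) * (P.c (n + 1) / P.pivot n) := by
  simp only [pivot, minor]
  field_simp

namespace TailDominant

variable (H : P.TailDominant)
include H

theorem abs_b_pos (n : ℕ) : 0 < |P.b (n + 1)| := abs_pos.2 (H.mu_ne_zero _ (by omega))

theorem abs_a_le (n : ℕ) : |P.a (n + 1)| ≤ P.δ * |P.b (n + 1)| := H.abs_lam_le_mu _ (by omega)

theorem abs_c_le (n : ℕ) : |P.c (n + 1)| ≤ P.δ * |P.b (n + 1)| := H.abs_beta_le_mu _ (by omega)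

theorem abs_c_le_of_le_abs_pivot {n : ℕ} (h : P.γ * |P.b (n + 1)| ≤ |P.pivot n|) :
    |P.c (n + 1)| ≤ P.θ * |P.pivot n| :=
  calc |P.c (n + 1)| ≤ P.δ * |P.b (n + 1)| := H.abs_c_le n
    _ = P.θ * (P.γ * |P.b (n + 1)|) := by rw [← H.θ_mul_γ, mul_assoc]
    _ ≤ P.θ * |P.pivot n| := mul_le_mul_of_nonneg_left h H.θ_pos.le

-- `γ` is a fixed point of `t ↦ 1 - δ² / t`, so the lower bound reproduces itself along the
-- recursion of the pivots.
theorem le_abs_pivot (n : ℕ) : P.γ * |P.b (n + 1)| ≤ |P.pivot n| := by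
  induction n with
  | zero =>
    rw [pivot_zero]
    exact mul_le_of_le_one_left (abs_nonneg _) H.γ_le_one
  | succ n ih =>
    have hpivot : 0 < |P.pivot n| := (mul_pos H.γ_pos (H.abs_b_pos n)).trans_le ih
    have hminor : P.minor (n + 1) ≠ 0 := (div_ne_zero_iff.1 (abs_pos.1 hpivot)).1
    have hratio : |P.c (n + 1) / P.pivot n| ≤ P.θ := by
      rw [abs_div, div_le_iff₀ hpivot]
      exact H.abs_c_le_of_le_abs_pivot ih
    calc P.γ * |P.b (n + 2)| = |P.b (n + 2)| - P.δ * |P.b (n + 2)| * P.θ := by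
          rw [H.γ_eq_one_sub]; ring
      _ ≤ |P.b (n + 2)| - |P.a (n + 2)| * |P.c (n + 1) / P.pivot n| :=
          sub_le_sub_left (mul_le_mul (H.abs_a_le _) hratio (abs_nonneg _)
            (mul_nonneg H.δ_pos.le (abs_nonneg _))) _
      _ ≤ |P.b (n + 2) - P.a (n + 2) * (P.c (n + 1) / P.pivot n)| := by
          rw [← abs_mul]; exact abs_sub_abs_le_abs_sub _ _
      _ = |P.pivot (n + 1)| := by rw [pivot_succ hminor]

theorem pivot_ne_zero (n : ℕ) : P.pivot n ≠ 0 :=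
  abs_pos.1 ((mul_pos H.γ_pos (H.abs_b_pos n)).trans_le (H.le_abs_pivot n))

theorem minor_ne_zero (n : ℕ) : P.minor n ≠ 0 := (div_ne_zero_iff.1 (H.pivot_ne_zero n)).2

theorem abs_c_le_θ_mul_pivot (n : ℕ) : |P.c (n + 1)| ≤ P.θ * |P.pivot n| :=
  H.abs_c_le_of_le_abs_pivot (H.le_abs_pivot n)

theorem abs_div_pivot_le {x : ℝ} {n j : ℕ} (hx : |x| ≤ P.δ * |P.b (j + 1)|) :
    |x / P.pivot n| ≤ P.θ * (|P.b (j + 1)| / |P.b (n + 1)|) := by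
  have hb := H.abs_b_pos n
  rw [abs_div, div_le_iff₀ (abs_pos.2 (H.pivot_ne_zero n))]
  calc |x| ≤ P.δ * |P.b (j + 1)| := hx
    _ = P.θ * (|P.b (j + 1)| / |P.b (n + 1)|) * (P.γ * |P.b (n + 1)|) := by
        rw [← H.θ_mul_γ]; field_simp
    _ ≤ P.θ * (|P.b (j + 1)| / |P.b (n + 1)|) * |P.pivot n| :=
        mul_le_mul_of_nonneg_left (H.le_abs_pivot n) (by have := H.θ_pos; positivity)

end TailDominant

/-! ### The lower factor -/

theorem LIinv_eq_sum_range {k : ℕ} (hk : P.minor k ≠ 0) (y : ℕ → ℝ) :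
    P.LIinv y k = ∑ l ∈ Finset.range (k + 1),
      (-1) ^ l * (∏ i ∈ Finset.Icc (k - l + 2) (k + 1), P.a i) * (P.minor (k - l) / P.minor k)
        * y (k - l) := by
  have hIcc : Finset.Icc 1 k = Finset.Ioo 0 (k + 1) := by
    ext; simp only [Finset.mem_Icc, Finset.mem_Ioo]; omega
  rw [Finset.range_eq_Ico, ← Finset.sum_Ioo_add_eq_sum_Ico k.succ_pos, add_comm, LIinv, hIcc]
  simp [hk]

@[simp]
theorem LIinv_apply_zero (P : Data) (y : ℕ → ℝ) : P.LIinv y 0 = y 0 := by simp [LIinv]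

theorem LIinv_add (P : Data) (y z : ℕ → ℝ) : P.LIinv (y + z) = P.LIinv y + P.LIinv z := by
  funext k
  simp only [LIinv, Pi.add_apply, mul_add, Finset.sum_add_distrib]
  ring

theorem LIinv_smul (P : Data) (r : ℝ) (y : ℕ → ℝ) : P.LIinv (r • y) = r • P.LIinv y := by
  funext k
  simp only [LIinv, Pi.smul_apply, smul_eq_mul, mul_add, Finset.mul_sum, mul_left_comm r]

/-- The tridiagonal tail, the operator that `L_I U_I` factors. -/
def tri (P : Data) (x : ℕ → ℝ) : ℕ → ℝ
  | 0 => P.b 1 * x 0 + P.c 1 * x 1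
  | k + 1 => P.a (k + 2) * x k + P.b (k + 2) * x (k + 1) + P.c (k + 2) * x (k + 2)

namespace TailDominant

variable (H : P.TailDominant)
include H

theorem LIinv_succ (y : ℕ → ℝ) (k : ℕ) :
    P.LIinv y (k + 1) = y (k + 1) - P.a (k + 2) / P.pivot k * P.LIinv y k := by
  have h0 := H.minor_ne_zero k
  have h1 := H.minor_ne_zero (k + 1)
  rw [LIinv_eq_sum_range h1, LIinv_eq_sum_range h0, Finset.sum_range_succ', Finset.mul_sum,
    sub_eq_add_neg, add_comm, ← Finset.sum_neg_distrib]
  congr 1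
  · simp [h1]
  · refine Finset.sum_congr rfl fun l _ => ?_
    rw [show k + 1 - (l + 1) = k - l by omega, Finset.prod_Icc_succ_top (by omega), pivot]
    field_simp
    ring

theorem abs_LIinv_le (y : ℕ → ℝ) (k : ℕ) :
    |P.LIinv y k| ≤ |P.b (k + 1)| * geomConv P.θ (fun j => |y j / P.b (j + 1)|) k := by
  have hmul : ∀ k, |P.b (k + 1)| * |y k / P.b (k + 1)| = |y k| := fun k => by
    rw [abs_div, mul_div_cancel₀ _ (H.abs_b_pos k).ne']
  induction k with
  | zero => simpa using (hmul 0).ge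
  | succ k ih =>
    have hb := H.abs_b_pos k
    have hθ := H.θ_pos
    rw [H.LIinv_succ, geomConv_succ, mul_add, hmul]
    set u := geomConv P.θ (fun j => |y j / P.b (j + 1)|) k
    refine (abs_sub _ _).trans (add_le_add_right ?_ _)
    rw [abs_mul]
    calc |P.a (k + 2) / P.pivot k| * |P.LIinv y k|
        ≤ P.θ * (|P.b (k + 2)| / |P.b (k + 1)|) * (|P.b (k + 1)| * u) :=
          mul_le_mul (H.abs_div_pivot_le (H.abs_a_le _)) ih (abs_nonneg _) (by positivity)
      _ = |P.b (k + 2)| * (P.θ * u) := by field_simp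

theorem LIinv_tri (x : ℕ → ℝ) (k : ℕ) :
    P.LIinv (P.tri x) k = P.pivot k * x k + P.c (k + 1) * x (k + 1) := by
  induction k with
  | zero => simp [tri]
  | succ k ih =>
    have hpivot := H.pivot_ne_zero k
    rw [H.LIinv_succ, ih, pivot_succ (H.minor_ne_zero (k + 1))]
    simp only [tri]
    field_simp
    ring

end TailDominant

/-! ### The upper factor -/

/-- The entry `(k, k + l)` of `U_I⁻¹`, the coefficient of `z_{k+l}` in the series for
`(U_I⁻¹ z)_k`. -/
def uCoeff (P : Data) (k l : ℕ) : ℝ :=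
  (-1) ^ l * (P.minor k / P.minor (k + l + 1)) * ∏ i ∈ Finset.Icc (k + 1) (k + l), P.c i

theorem tailInv_apply (P : Data) (y : ℕ → ℝ) (k : ℕ) :
    P.tailInv y k = ∑' l, P.uCoeff k l * P.LIinv y (k + l) := rfl

theorem tailInv_smul (P : Data) (r : ℝ) (y : ℕ → ℝ) :
    P.tailInv (r • y) = r • P.tailInv y := by
  funext k
  simp only [Pi.smul_apply, tailInv_apply, LIinv_smul, smul_eq_mul, ← tsum_mul_left, mul_left_comm]

theorem uCoeff_zero (P : Data) (k : ℕ) : P.uCoeff k 0 = (P.pivot k)⁻¹ := by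
  simp [uCoeff, pivot]

namespace TailDominant

variable (H : P.TailDominant)
include H

theorem uCoeff_succ (k l : ℕ) :
    P.uCoeff k (l + 1) = -(P.uCoeff k l * (P.c (k + l + 1) / P.pivot (k + l + 1))) := by
  have h1 := H.minor_ne_zero (k + l + 1)
  have h2 := H.minor_ne_zero (k + l + 2)
  unfold uCoeff pivot
  rw [← add_assoc, Finset.prod_Icc_succ_top (by omega)]
  field_simp
  ring

theorem abs_uCoeff_le (k l : ℕ) :
    |P.uCoeff k l| ≤ |P.b (k + 1) / P.pivot k| * (P.θ ^ l / |P.b (k + l + 1)|) := by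
  induction l with
  | zero =>
    have hb := H.abs_b_pos k
    rw [uCoeff_zero, abs_inv, abs_div, pow_zero, add_zero]
    exact le_of_eq (by field_simp)
  | succ l ih =>
    have hθ := H.θ_pos
    have hb := H.abs_b_pos (k + l)
    rw [H.uCoeff_succ, abs_neg, abs_mul]
    refine (mul_le_mul ih (H.abs_div_pivot_le (H.abs_c_le _)) (abs_nonneg _)
      (by positivity)).trans_eq ?_
    rw [← add_assoc, pow_succ]
    field_simp

theorem abs_uCoeff_mul_pivot_le (k l : ℕ) : |P.uCoeff k l * P.pivot (k + l)| ≤ P.θ ^ l := by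
  induction l with
  | zero => simp [uCoeff_zero, H.pivot_ne_zero]
  | succ l ih =>
    have hpivot := H.pivot_ne_zero (k + l + 1)
    rw [H.uCoeff_succ, ← add_assoc, neg_mul, abs_neg, mul_assoc, div_mul_cancel₀ _ hpivot, pow_succ,
      abs_mul]
    calc |P.uCoeff k l| * |P.c (k + l + 1)|
        ≤ |P.uCoeff k l| * (P.θ * |P.pivot (k + l)|) :=
          mul_le_mul_of_nonneg_left (H.abs_c_le_θ_mul_pivot _) (abs_nonneg _)
      _ = |P.uCoeff k l * P.pivot (k + l)| * P.θ := by rw [abs_mul]; ring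
      _ ≤ P.θ ^ l * P.θ := mul_le_mul_of_nonneg_right ih H.θ_pos.le

/-! ### The inverse of the tail -/

theorem abs_uCoeff_mul_LIinv_le (y : ℕ → ℝ) (k l : ℕ) :
    |P.uCoeff k l * P.LIinv y (k + l)|
      ≤ |P.b (k + 1) / P.pivot k| *
        (P.θ ^ l * geomConv P.θ (fun j => |y j / P.b (j + 1)|) (k + l)) := by
  have hθ := H.θ_pos
  have hb := H.abs_b_pos (k + l)
  rw [abs_mul]
  refine (mul_le_mul (H.abs_uCoeff_le k l) (H.abs_LIinv_le y (k + l)) (abs_nonneg _)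
    (by positivity)).trans_eq ?_
  field_simp

theorem summable_tailInv {y : ℕ → ℝ} {B : ℝ} (hy : ∀ j, |y j / P.b (j + 1)| ≤ B) (k : ℕ) :
    Summable fun l => P.uCoeff k l * P.LIinv y (k + l) :=
  .of_norm_bounded ((hasSum_pow_mul_geomConv H.θ_pos.le H.θ_lt_one
    (fun j => (abs_abs _).trans_le (hy j)) k).mul_left _).summable (H.abs_uCoeff_mul_LIinv_le y k)

theorem abs_tailInv_le {y : ℕ → ℝ} {B : ℝ} (hy : ∀ j, |y j / P.b (j + 1)| ≤ B) (k : ℕ) :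
    |P.tailInv y k| ≤ P.η * greenSum P.θ (fun j => |y j / P.b (j + 1)|) k := by
  have hsum := hasSum_pow_mul_geomConv H.θ_pos.le H.θ_lt_one
    (fun j => (abs_abs _).trans_le (hy j)) k
  have hratio : |P.b (k + 1) / P.pivot k| ≤ 1 / P.γ := by
    rw [abs_div, div_le_div_iff₀ (abs_pos.2 (H.pivot_ne_zero k)) H.γ_pos, one_mul, mul_comm]
    exact H.le_abs_pivot k
  calc |P.tailInv y k|
      ≤ |P.b (k + 1) / P.pivot k| *
        (greenSum P.θ (fun j => |y j / P.b (j + 1)|) k / (1 - P.θ ^ 2)) :=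
        tsum_of_norm_bounded (E := ℝ) (hsum.mul_left _) (H.abs_uCoeff_mul_LIinv_le y k)
    _ ≤ 1 / P.γ * (greenSum P.θ (fun j => |y j / P.b (j + 1)|) k / (1 - P.θ ^ 2)) :=
        mul_le_mul_of_nonneg_right hratio (hsum.nonneg fun l => mul_nonneg (pow_nonneg H.θ_pos.le _)
          (Finset.sum_nonneg fun j _ => mul_nonneg (pow_nonneg H.θ_pos.le _) (abs_nonneg _)))
    _ = P.η * greenSum P.θ (fun j => |y j / P.b (j + 1)|) k := by
        rw [η, div_mul_div_comm, one_mul, div_mul_eq_mul_div, one_mul]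

theorem tailInv_add {y z : ℕ → ℝ} {B B' : ℝ} (hy : ∀ j, |y j / P.b (j + 1)| ≤ B)
    (hz : ∀ j, |z j / P.b (j + 1)| ≤ B') : P.tailInv (y + z) = P.tailInv y + P.tailInv z := by
  funext k
  simp only [Pi.add_apply, tailInv_apply, LIinv_add, mul_add]
  exact (H.summable_tailInv hy k).tsum_add (H.summable_tailInv hz k)

-- The series telescopes: with `t_l = U⁻¹_{k,k+l} · pivot_{k+l} · x_{k+l}` its terms are
-- `t_l - t_{l+1}`, and `t_0 = x_k`.
theorem tailInv_tri {x : ℕ → ℝ} {B : ℝ} (hx : ∀ j, |x j| ≤ B) : P.tailInv (P.tri x) = x := by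
  funext k
  set t : ℕ → ℝ := fun l => P.uCoeff k l * P.pivot (k + l) * x (k + l) with ht
  have hterm : ∀ l, P.uCoeff k l * P.LIinv (P.tri x) (k + l) = t l - t (l + 1) := fun l => by
    have hpivot := H.pivot_ne_zero (k + l + 1)
    simp only [ht, H.LIinv_tri, H.uCoeff_succ, ← add_assoc]
    field_simp
    ring
  have hsummable : Summable t := by
    refine .of_norm_bounded
      ((summable_geometric_of_lt_one H.θ_pos.le H.θ_lt_one).mul_right B) fun l => ?_
    rw [Real.norm_eq_abs, abs_mul]
    exact mul_le_mul (H.abs_uCoeff_mul_pivot_le k l) (hx _) (abs_nonneg _)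
      (pow_nonneg H.θ_pos.le _)
  rw [tailInv_apply]
  simp only [hterm]
  rw [hsummable.tsum_sub ((summable_nat_add_iff 1).2 hsummable), hsummable.tsum_eq_zero_add,
    add_sub_cancel_right]
  simp [ht, uCoeff_zero, H.pivot_ne_zero]

end TailDominant

/-! ### The vector `w` and the truncation `w̃` -/

theorem abs_single_div_b (P : Data) :
    (fun j => |(Pi.single 0 1 : ℕ → ℝ) j / P.b (j + 1)|) = Pi.single 0 (1 / |P.mu P.m|) := by
  funext j
  rcases j with _ | j
  · simp [b]
  · simp

theorem abs_single_div_b_le (P : Data) (j : ℕ) :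
    |(Pi.single 0 1 : ℕ → ℝ) j / P.b (j + 1)| ≤ 1 / |P.mu P.m| := by
  rw [congrFun (abs_single_div_b P) j, Pi.single_apply]
  split_ifs
  · exact le_rfl
  · positivity

namespace TailDominant

variable (H : P.TailDominant)
include H

theorem abs_wI_le (k : ℕ) : |P.wI k| ≤ P.η * P.θ ^ k / |P.mu P.m| := by
  refine (H.abs_tailInv_le (abs_single_div_b_le P) k).trans_eq ?_
  rw [abs_single_div_b, greenSum_single]
  ring

theorem LIinv_single (k : ℕ) :
    P.LIinv (Pi.single 0 1) k
      = (-1) ^ k * (∏ i ∈ Finset.Icc 2 (k + 1), P.a i) * (1 / P.minor k) := by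
  induction k with
  | zero => simp [minor]
  | succ k ih =>
    have h0 := H.minor_ne_zero k
    rw [H.LIinv_succ, ih, Finset.prod_Icc_succ_top (by omega : 2 ≤ k + 1 + 1), pivot,
      Pi.single_eq_of_ne k.succ_ne_zero, pow_succ]
    field_simp
    ring

theorem abs_uCoeff_mul_LIinv_single_le (l : ℕ) :
    |P.uCoeff 0 l * P.LIinv (Pi.single 0 1) l| ≤ (P.θ ^ 2) ^ l / |P.mu P.m| := by
  have h := H.abs_uCoeff_mul_LIinv_le (Pi.single 0 1) 0 l
  have hgeom : geomConv P.θ (Pi.single 0 (1 / |P.mu P.m|)) l = P.θ ^ l / |P.mu P.m| := by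
    simp [geomConv, Pi.single_apply, div_eq_mul_inv]
  rw [pivot_zero, div_self (abs_pos.1 (H.abs_b_pos 0)), abs_one, one_mul, abs_single_div_b,
    zero_add, hgeom] at h
  refine h.trans_eq ?_
  ring

theorem wTilde_eq_sum (hL : 1 ≤ P.L) :
    P.wTilde = ∑ l ∈ Finset.range P.L, P.uCoeff 0 l * P.LIinv (Pi.single 0 1) l := by
  rw [Finset.range_eq_Ico, ← Finset.sum_Ioo_add_eq_sum_Ico (by omega), add_comm, wTilde]
  congr 1
  · simp [uCoeff_zero, pivot]
  · have hIcc : Finset.Icc 1 (P.L - 1) = Finset.Ioo 0 P.L := by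
      ext; simp only [Finset.mem_Icc, Finset.mem_Ioo]; omega
    refine Finset.sum_congr hIcc fun l _ => ?_
    have hsign : ((-1 : ℝ) ^ l) * (-1) ^ l = 1 := by rw [← mul_pow]; simp
    simp only [H.LIinv_single, uCoeff, zero_add, minor]
    linear_combination (-(1 / (P.minor l * P.minor (l + 1))) * (∏ i ∈ Finset.Icc 1 l, P.c i)
      * ∏ i ∈ Finset.Icc 2 (l + 1), P.a i) * hsign

theorem abs_wI_sub_wTilde_le (hL : 1 ≤ P.L) :
    |P.wI 0 - P.wTilde| ≤ P.θ ^ (2 * P.L) / (|P.mu P.m| * (1 - P.θ ^ 2)) := by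
  have hsplit := (H.summable_tailInv (abs_single_div_b_le P) 0).sum_add_tsum_nat_add P.L
  simp only [zero_add] at hsplit
  have htail : P.wI 0 - P.wTilde
      = ∑' l, P.uCoeff 0 (l + P.L) * P.LIinv (Pi.single 0 1) (l + P.L) := by
    rw [H.wTilde_eq_sum hL, wI, tailInv_apply, sub_eq_iff_eq_add']
    simpa only [zero_add] using hsplit.symm
  have hgeo := (hasSum_geometric_of_lt_one (sq_nonneg P.θ) H.θ_sq_lt_one).mul_left
    ((P.θ ^ 2) ^ P.L / |P.mu P.m|)
  rw [htail]
  refine (tsum_of_norm_bounded (E := ℝ) hgeo fun l => ?_).trans_eq ?_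
  · refine (H.abs_uCoeff_mul_LIinv_single_le _).trans_eq ?_
    rw [pow_add]
    ring
  · rw [← pow_mul, div_mul_eq_div_div, div_eq_mul_inv _ (1 - P.θ ^ 2)]

end TailDominant

end Data

/-! ### Partial sums of `∑ l⁻ˢ` -/

theorem sum_Icc_one (f : ℕ → ℝ) (n : ℕ) :
    ∑ l ∈ Finset.Icc 1 n, f l = ∑ l ∈ Finset.range n, f (l + 1) := by
  rw [← Finset.Ico_add_one_right_eq_Icc, Finset.sum_Ico_eq_sum_range]
  simp only [Nat.add_sub_cancel, add_comm 1]

theorem summable_one_div_add_one_rpow {s : ℝ} (hs : 1 < s) :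
    Summable fun l : ℕ => 1 / ((l + 1 : ℕ) : ℝ) ^ s :=
  (summable_nat_add_iff 1).2 (Real.summable_one_div_nat_rpow.2 hs)

theorem tsum_one_div_add_one_rpow_tail_le {s : ℝ} (hs : 1 < s) {n : ℕ} (hn : 1 ≤ n) :
    ∑' l : ℕ, 1 / ((l + n + 1 : ℕ) : ℝ) ^ s ≤ 1 / ((s - 1) * (n : ℝ) ^ (s - 1)) := by
  have hn0 : (0 : ℝ) < n := by exact_mod_cast hn
  have hs1 : 0 < s - 1 := by linarith
  refine Real.tsum_le_of_sum_range_le (fun l => by positivity) fun N => ?_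
  have hanti : AntitoneOn (fun x : ℝ => x ^ (-s)) (Set.Icc (n : ℝ) (n + N)) := fun x hx y _ hxy =>
    Real.rpow_le_rpow_of_nonpos (hn0.trans_le hx.1) hxy (by linarith)
  have hint := hanti.sum_le_integral
  rw [integral_rpow (Or.inr ⟨by linarith, fun h => ?_⟩)] at hint
  · calc ∑ l ∈ Finset.range N, 1 / ((l + n + 1 : ℕ) : ℝ) ^ s
        = ∑ l ∈ Finset.range N, ((n : ℝ) + (l + 1 : ℕ)) ^ (-s) := by
          refine Finset.sum_congr rfl fun l _ => ?_
          rw [Real.rpow_neg (by positivity), one_div]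
          push_cast
          ring_nf
      _ ≤ _ := hint
      _ = 1 / ((s - 1) * (n : ℝ) ^ (s - 1)) - ((n : ℝ) + N) ^ (-s + 1) / (s - 1) := by
          rw [show -s + 1 = -(s - 1) by ring, Real.rpow_neg hn0.le]
          field_simp
          ring
      _ ≤ _ := sub_le_self _ (by positivity)
  · rw [Set.uIcc_of_le (by simp)] at h
    exact hn0.not_ge h.1

theorem two_mul_tsum_le_zetaUp {s : ℝ} (hs : 1 < s) {L : ℕ} (hL : 1 ≤ L) :
    2 * ∑' l : ℕ, 1 / ((l + 1 : ℕ) : ℝ) ^ s ≤ zetaUp s L := by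
  rw [← (summable_one_div_add_one_rpow hs).sum_add_tsum_nat_add L, mul_add, zetaUp, sum_Icc_one,
    ← mul_one_div 2 ((s - 1) * _)]
  gcongr
  exact tsum_one_div_add_one_rpow_tail_le hs hL

theorem two_mul_sum_le_zetaUp {s : ℝ} (hs : 1 < s) {L : ℕ} (hL : 1 ≤ L) (n : ℕ) :
    2 * ∑ l ∈ Finset.Icc 1 n, 1 / (l : ℝ) ^ s ≤ zetaUp s L := by
  refine le_trans ?_ (two_mul_tsum_le_zetaUp hs hL)
  rw [sum_Icc_one]
  gcongr
  exact (summable_one_div_add_one_rpow hs).sum_le_tsum _ fun _ _ => by positivity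

/-! ### Estimates for the convolution -/

/-- The part `0 ≤ j ≤ k` of the sum `∑_j ω_k / (ω_{|j|} ω_{|k-j|})`. -/
def convWeight (s : ℝ) (k : ℕ) : ℝ :=
  ∑ j ∈ Finset.range (k + 1), wt s k / (wt s j * wt s (k - j))

/-- The terms of the convolution at `k` of `1 / ω` with itself, multiplied by `ω_k`. Their sum over
`j` is the constant in the inequality `‖x * y‖ ≤ C ‖x‖ ‖y‖`. -/
def convTerm (s : ℝ) (k : ℕ) (j : ℤ) : ℝ :=
  wt s k / (wt s j.natAbs * wt s ((k : ℤ) - j).natAbs)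

theorem convTerm_nonneg (s : ℝ) (k : ℕ) (j : ℤ) : 0 ≤ convTerm s k j :=
  div_nonneg (wt_pos _ _).le (mul_pos (wt_pos _ _) (wt_pos _ _)).le

theorem wt_div_wt_mul_wt_add_le {s : ℝ} (hs : 0 ≤ s) (k n : ℕ) :
    wt s k / (wt s (n + 1) * wt s (k + n + 1)) ≤ 1 / ((n + 1 : ℕ) : ℝ) ^ s := by
  rw [← wt_of_ne_zero s n.succ_ne_zero,
    div_le_div_iff₀ (mul_pos (wt_pos _ _) (wt_pos _ _)) (wt_pos _ _), one_mul, mul_comm]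
  exact mul_le_mul_of_nonneg_left (wt_mono hs (by omega)) (wt_pos _ _).le

theorem convTerm_neg_le {s : ℝ} (hs : 0 ≤ s) (k n : ℕ) :
    convTerm s k (-((n : ℤ) + 1)) ≤ 1 / ((n + 1 : ℕ) : ℝ) ^ s := by
  have h := wt_div_wt_mul_wt_add_le hs k n
  rwa [convTerm, show (-((n : ℤ) + 1)).natAbs = n + 1 by omega,
    show ((k : ℤ) - -((n : ℤ) + 1)).natAbs = k + n + 1 by omega]

theorem convTerm_add_le {s : ℝ} (hs : 0 ≤ s) (k n : ℕ) :
    convTerm s k ((n + (k + 1) : ℕ) : ℤ) ≤ 1 / ((n + 1 : ℕ) : ℝ) ^ s := by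
  have h := wt_div_wt_mul_wt_add_le hs k n
  rwa [convTerm, Int.natAbs_natCast, show n + (k + 1) = k + n + 1 by ring,
    show ((k : ℤ) - ((k + n + 1 : ℕ) : ℤ)).natAbs = n + 1 by omega, mul_comm (wt s _)]

section

variable {s : ℝ} (hs : 1 < s)
include hs

theorem summable_convTerm_neg (k : ℕ) : Summable fun n : ℕ => convTerm s k (-((n : ℤ) + 1)) :=
  Summable.of_nonneg_of_le (fun _ => convTerm_nonneg _ _ _)
    (fun n => convTerm_neg_le (by linarith) k n) (summable_one_div_add_one_rpow hs)

theorem summable_convTerm_nat (k : ℕ) : Summable fun n : ℕ => convTerm s k n :=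
  (summable_nat_add_iff (k + 1)).1 (Summable.of_nonneg_of_le (fun _ => convTerm_nonneg _ _ _)
    (fun n => convTerm_add_le (by linarith) k n) (summable_one_div_add_one_rpow hs))

theorem summable_convTerm (k : ℕ) : Summable (convTerm s k) :=
  Summable.of_nat_of_neg_add_one (summable_convTerm_nat hs k) (summable_convTerm_neg hs k)

theorem tsum_convTerm_le {L : ℕ} (hL : 1 ≤ L) (k : ℕ) :
    ∑' j, convTerm s k j ≤ convWeight s k + zetaUp s L := by
  have hs0 : 0 ≤ s := by linarith
  have hsum := summable_one_div_add_one_rpow hs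
  have hnat := summable_convTerm_nat hs k
  have hmiddle : ∑ n ∈ Finset.range (k + 1), convTerm s k n = convWeight s k := by
    refine Finset.sum_congr rfl fun n hn => ?_
    have := Finset.mem_range.1 hn
    rw [convTerm, show ((k : ℤ) - n).natAbs = k - n by omega, Int.natAbs_natCast]
  have hright := ((summable_nat_add_iff (k + 1)).2 hnat).tsum_le_tsum (convTerm_add_le hs0 k) hsum
  have hleft := (summable_convTerm_neg hs k).tsum_le_tsum (convTerm_neg_le hs0 k) hsum
  rw [tsum_of_nat_of_neg_add_one hnat (summable_convTerm_neg hs k),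
    ← hnat.sum_add_tsum_nat_add (k + 1), hmiddle]
  linarith [two_mul_tsum_le_zetaUp hs hL]

end

theorem abs_mul_le_convTerm {s : ℝ} (x y : Omega s) (k : ℕ) (j : ℤ) :
    |x j.natAbs * y ((k : ℤ) - j).natAbs| ≤ ‖x‖ * ‖y‖ / wt s k * convTerm s k j := by
  have hk := (wt_pos s k).ne'
  calc |x j.natAbs * y ((k : ℤ) - j).natAbs|
      ≤ ‖x‖ / wt s j.natAbs * (‖y‖ / wt s ((k : ℤ) - j).natAbs) := by
        rw [abs_mul]
        exact mul_le_mul (x.abs_le _) (y.abs_le _) (abs_nonneg _)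
          (div_nonneg (norm_nonneg _) (wt_pos _ _).le)
    _ = ‖x‖ * ‖y‖ / wt s k * convTerm s k j := by
        rw [convTerm, div_mul_div_comm, div_mul_div_comm, mul_comm _ (wt s k),
          mul_div_mul_left _ _ hk]

theorem summable_conv {s : ℝ} (hs : 1 < s) (x y : Omega s) (k : ℕ) :
    Summable fun j : ℤ => x j.natAbs * y ((k : ℤ) - j).natAbs :=
  Summable.of_norm_bounded ((summable_convTerm hs k).mul_left _) (abs_mul_le_convTerm x y k)

theorem abs_conv_le {s : ℝ} (hs : 1 < s) {L : ℕ} (hL : 1 ≤ L) (x y : Omega s) (k : ℕ) :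
    |conv x y k| ≤ (convWeight s k + zetaUp s L) * ‖x‖ * ‖y‖ / wt s k :=
  calc |conv x y k|
      ≤ ‖x‖ * ‖y‖ / wt s k * ∑' j, convTerm s k j :=
        tsum_of_norm_bounded (f := fun j : ℤ => x j.natAbs * y ((k : ℤ) - j).natAbs)
          ((summable_convTerm hs k).hasSum.mul_left _) (abs_mul_le_convTerm x y k)
    _ ≤ ‖x‖ * ‖y‖ / wt s k * (convWeight s k + zetaUp s L) :=
        mul_le_mul_of_nonneg_left (tsum_convTerm_le hs hL k)
          (div_nonneg (by positivity) (wt_pos _ _).le)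
    _ = _ := by ring

theorem conv_comm (x y : ℕ → ℝ) (k : ℕ) : conv x y k = conv y x k := by
  unfold conv
  rw [← (Equiv.subLeft (k : ℤ)).tsum_eq]
  simp only [Equiv.subLeft_apply, sub_sub_cancel, mul_comm]

theorem conv_add_right {s : ℝ} (hs : 1 < s) (x y z : Omega s) (k : ℕ) :
    conv x (y + z : Omega s) k = conv x y k + conv x z k := by
  unfold conv
  rw [← (summable_conv hs x y k).tsum_add (summable_conv hs x z k)]
  exact tsum_congr fun j => mul_add _ _ _

theorem conv_smul_right (x y : ℕ → ℝ) (c : ℝ) (k : ℕ) :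
    conv x (c • y) k = c * conv x y k := by
  unfold conv
  rw [← tsum_mul_left]
  exact tsum_congr fun j => mul_left_comm _ _ _

/-! ### The constants `α` -/

/-- The sum over `0 < l < k` in the constant `α_k`, rewritten with `k / (l (k - l)) = 1/l +
1/(k - l)`. -/
def splitSum (s : ℝ) (k : ℕ) : ℝ :=
  ∑ l ∈ Finset.Icc 1 (k - 1), (1 / (l : ℝ) + 1 / ((k - l : ℕ) : ℝ)) ^ s

/-- The bound for `splitSum s k`, `k ≥ n`, that enters the constant `α_n` when `s ≥ 2`. -/
def splitBound (s : ℝ) (n : ℕ) : ℝ :=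
  2 * ((n : ℝ) / ((n : ℝ) - 1)) ^ s
    + (4 * Real.log ((n : ℝ) - 2) / (n : ℝ) + (Real.pi ^ 2 - 6) / 3)
      * (2 / (n : ℝ) + 1 / 2) ^ (s - 2)

theorem rpow_div_rpow_mul_rpow (s : ℝ) {k l : ℕ} (hl : 0 < l) (hlk : l < k) :
    (k : ℝ) ^ s / ((l : ℝ) ^ s * ((k - l : ℕ) : ℝ) ^ s)
      = (1 / (l : ℝ) + 1 / ((k - l : ℕ) : ℝ)) ^ s := by
  obtain ⟨n, rfl⟩ := Nat.exists_eq_add_of_lt hlk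
  rw [show l + n + 1 - l = n + 1 by omega, ← Real.mul_rpow (by positivity) (by positivity),
    ← Real.div_rpow (by positivity) (by positivity)]
  congr 1
  have : (l : ℝ) ≠ 0 := by positivity
  have : ((n + 1 : ℕ) : ℝ) ≠ 0 := by positivity
  field_simp
  push_cast
  ring

theorem convWeight_zero (s : ℝ) : convWeight s 0 = 1 := by simp [convWeight]

theorem convWeight_eq (s : ℝ) {k : ℕ} (hk : k ≠ 0) : convWeight s k = 2 + splitSum s k := by
  obtain ⟨n, rfl⟩ := Nat.exists_eq_succ_of_ne_zero hk
  have hn := (wt_pos s (n + 1)).ne'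
  have hmiddle : ∑ l ∈ Finset.range n, wt s (n + 1) / (wt s (l + 1) * wt s (n + 1 - (l + 1)))
      = splitSum s (n + 1) := by
    rw [splitSum, Nat.add_sub_cancel, sum_Icc_one]
    refine Finset.sum_congr rfl fun l hl => ?_
    have := Finset.mem_range.1 hl
    rw [← rpow_div_rpow_mul_rpow s l.succ_pos (by omega), wt_of_ne_zero s n.succ_ne_zero,
      wt_of_ne_zero s l.succ_ne_zero, wt_of_ne_zero s (by omega)]
  rw [convWeight, Finset.sum_range_succ', Finset.sum_range_succ, hmiddle, Nat.succ_eq_add_one,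
    Nat.sub_self, Nat.sub_zero, wt_zero_right, mul_one, one_mul, div_self hn]
  ring

theorem convWeight_add_zetaUp_eq_alpha (s : ℝ) (L : ℕ) {n k : ℕ} (hk : k < n) :
    convWeight s k + zetaUp s L = alpha s L n k := by
  unfold alpha
  split_ifs with h
  · rw [h, convWeight_zero]
  · rw [convWeight_eq s h, splitSum, add_right_comm]
    congr 1
    refine Finset.sum_congr rfl fun l hl => ?_
    rw [Finset.mem_Icc] at hl
    rw [← rpow_div_rpow_mul_rpow s hl.1 (by omega), Nat.cast_sub (by omega)]

theorem sum_Icc_sub_reflect (f : ℕ → ℝ) {i k : ℕ} (h : i ≤ k) :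
    ∑ l ∈ Finset.Icc i (k - i), f (k - l) = ∑ l ∈ Finset.Icc i (k - i), f l := by
  refine Finset.sum_nbij' (k - ·) (k - ·) ?_ ?_ ?_ ?_ ?_ <;>
    simp only [Finset.mem_Icc] <;> intros <;> first | omega | trivial

theorem add_rpow_le {a b p : ℝ} (ha : 0 ≤ a) (hb : 0 ≤ b) (hp : 1 ≤ p) :
    (a + b) ^ p ≤ 2 ^ (p - 1) * (a ^ p + b ^ p) := by
  have := NNReal.rpow_add_le_mul_rpow_add_rpow ⟨a, ha⟩ ⟨b, hb⟩ hp
  exact_mod_cast this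

theorem splitSum_le {s : ℝ} (hs : 1 < s) {L : ℕ} (hL : 1 ≤ L) {k : ℕ} (hk : k ≠ 0) :
    splitSum s k ≤ 2 ^ (s - 1) * zetaUp s L :=
  calc splitSum s k
      ≤ ∑ l ∈ Finset.Icc 1 (k - 1),
          2 ^ (s - 1) * (1 / (l : ℝ) ^ s + 1 / ((k - l : ℕ) : ℝ) ^ s) := by
        refine Finset.sum_le_sum fun l _ =>
          (add_rpow_le (by positivity) (by positivity) hs.le).trans_eq ?_
        rw [Real.div_rpow zero_le_one (by positivity), Real.div_rpow zero_le_one (by positivity),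
          Real.one_rpow]
    _ = 2 ^ (s - 1) * (2 * ∑ l ∈ Finset.Icc 1 (k - 1), 1 / (l : ℝ) ^ s) := by
        rw [← Finset.mul_sum, Finset.sum_add_distrib,
          sum_Icc_sub_reflect (fun l => 1 / (l : ℝ) ^ s) (Nat.one_le_iff_ne_zero.2 hk), two_mul]
    _ ≤ 2 ^ (s - 1) * zetaUp s L := by
        gcongr
        exact two_mul_sum_le_zetaUp hs hL _

theorem sum_Icc_two_one_div_le_log (n : ℕ) :
    ∑ l ∈ Finset.Icc 2 n, 1 / (l : ℝ) ≤ Real.log n := by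
  rcases Nat.eq_zero_or_pos n with rfl | hn
  · simp
  have h := harmonic_le_one_add_log n
  rw [harmonic_eq_sum_Icc, ← Finset.add_sum_Ioc_eq_sum_Icc hn,
    show Finset.Ioc 1 n = Finset.Icc 2 n from rfl] at h
  push_cast at h
  simpa only [inv_one, one_div, add_le_add_iff_left] using h

theorem sum_Icc_two_one_div_sq_le (n : ℕ) :
    ∑ l ∈ Finset.Icc 2 n, 1 / (l : ℝ) ^ 2 ≤ Real.pi ^ 2 / 6 - 1 := by
  have h := sum_le_hasSum (insert 1 (Finset.Icc 2 n)) (fun l _ => by positivity) hasSum_zeta_two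
  rw [Finset.sum_insert (by simp), Nat.cast_one, one_pow, div_one] at h
  linarith

theorem log_le_sub_inv_div_two {x : ℝ} (hx : 1 ≤ x) : Real.log x ≤ (x - x⁻¹) / 2 := by
  rw [← Real.sinh_log (by linarith)]
  exact Real.self_le_sinh_iff.2 (Real.log_nonneg hx)

-- The real function `log (x - 2) / x` still increases at `x = 6`: the unit step is essential.
theorem log_sub_two_div_antitoneOn :
    AntitoneOn (fun k : ℕ => Real.log ((k : ℝ) - 2) / k) (Set.Ici 6) := by
  refine antitoneOn_nat_Ici_of_succ_le fun k hk => ?_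
  have hk6 : (6 : ℝ) ≤ k := by exact_mod_cast hk
  have hk2 : (0 : ℝ) < k - 2 := by linarith
  have hratio : (k : ℝ) * Real.log ((k - 1) / (k - 2)) ≤ 27 / 20 := by
    have h := log_le_sub_inv_div_two (x := ((k : ℝ) - 1) / (k - 2))
      ((one_le_div hk2).2 (by linarith))
    refine (mul_le_mul_of_nonneg_left h k.cast_nonneg).trans ?_
    have hk1 : (k : ℝ) - 1 ≠ 0 := by linarith
    rw [inv_div, div_sub_div _ _ hk2.ne' hk1, div_div, mul_div_assoc',
      div_le_div_iff₀ (by nlinarith) (by norm_num)]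
    nlinarith
  have hlog : 27 / 20 ≤ Real.log ((k : ℝ) - 2) := by
    have h4 : Real.log 4 ≤ Real.log ((k : ℝ) - 2) := Real.log_le_log (by norm_num) (by linarith)
    rw [show (4 : ℝ) = 2 ^ 2 by norm_num, Real.log_pow] at h4
    push_cast at h4
    linarith [Real.log_two_gt_d9]
  rw [Real.log_div (by linarith) hk2.ne'] at hratio
  rw [div_le_div_iff₀ (by positivity) (by positivity)]
  push_cast
  rw [show (k : ℝ) + 1 - 2 = k - 1 by ring]
  linarith

theorem splitSum_eq {s : ℝ} {k : ℕ} (hk : 3 ≤ k) :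
    splitSum s k = 2 * ((k : ℝ) / (k - 1)) ^ s
      + ∑ l ∈ Finset.Icc 2 (k - 2), (1 / (l : ℝ) + 1 / ((k - l : ℕ) : ℝ)) ^ s := by
  obtain ⟨n, rfl⟩ := Nat.exists_eq_add_of_le' hk
  have hend : 1 + 1 / ((n : ℝ) + 2) = (n + 3) / (n + 3 - 1) := by
    rw [show (n : ℝ) + 3 - 1 = n + 2 by ring]
    field_simp
    ring
  rw [splitSum, show n + 3 - 1 = n + 1 + 1 by omega, Finset.sum_Icc_succ_top (by omega),
    ← Finset.add_sum_Ioc_eq_sum_Icc (by omega), show n + 3 - 2 = n + 1 by omega,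
    show Finset.Ioc 1 (n + 1) = Finset.Icc 2 (n + 1) from rfl,
    show n + 3 - (n + 1 + 1) = 1 by omega, show n + 3 - 1 = n + 1 + 1 by omega]
  push_cast
  rw [← hend, show (n : ℝ) + 1 + 1 = n + 2 by ring, div_one, add_comm (1 / ((n : ℝ) + 2)) 1]
  ring

theorem one_div_add_one_div_le {u v : ℝ} (hu : 2 ≤ u) (hv : 2 ≤ v) :
    1 / u + 1 / v ≤ 2 / (u + v) + 1 / 2 := by
  rw [div_add_div _ _ (by positivity) (by positivity),
    div_add_div _ _ (by positivity) (by norm_num),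
    div_le_div_iff₀ (by positivity) (by positivity)]
  nlinarith [mul_nonneg (sub_nonneg.2 hu) (sub_nonneg.2 hv)]

theorem one_div_add_one_div_rpow_le {s : ℝ} (hs : 2 ≤ s) {u v : ℝ} (hu : 2 ≤ u) (hv : 2 ≤ v) :
    (1 / u + 1 / v) ^ s
      ≤ (1 / u ^ 2 + 1 / v ^ 2 + 2 / (u + v) * (1 / u + 1 / v))
        * (2 / (u + v) + 1 / 2) ^ (s - 2) :=
  calc (1 / u + 1 / v) ^ s
      = (1 / u + 1 / v) ^ 2 * (1 / u + 1 / v) ^ (s - 2) := by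
        rw [← Real.rpow_natCast, ← Real.rpow_add (by positivity)]
        norm_num
    _ = (1 / u ^ 2 + 1 / v ^ 2 + 2 / (u + v) * (1 / u + 1 / v)) * (1 / u + 1 / v) ^ (s - 2) := by
        congr 1
        have : u ≠ 0 := by positivity
        have : v ≠ 0 := by positivity
        field_simp
        ring
    _ ≤ _ := mul_le_mul_of_nonneg_left
        (Real.rpow_le_rpow (by positivity) (one_div_add_one_div_le hu hv) (by linarith))
        (by positivity)

theorem splitSum_le_splitBound {s : ℝ} (hs : 2 ≤ s) {k : ℕ} (hk : 3 ≤ k) :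
    splitSum s k ≤ splitBound s k := by
  have hlog := sum_Icc_two_one_div_le_log (k - 2)
  rw [Nat.cast_sub (by omega), Nat.cast_ofNat] at hlog
  rw [splitSum_eq hk, splitBound]
  gcongr
  calc ∑ l ∈ Finset.Icc 2 (k - 2), (1 / (l : ℝ) + 1 / ((k - l : ℕ) : ℝ)) ^ s
      ≤ ∑ l ∈ Finset.Icc 2 (k - 2), (1 / (l : ℝ) ^ 2 + 1 / ((k - l : ℕ) : ℝ) ^ 2
          + 2 / k * (1 / (l : ℝ) + 1 / ((k - l : ℕ) : ℝ))) * (2 / (k : ℝ) + 1 / 2) ^ (s - 2) := by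
        refine Finset.sum_le_sum fun l hl => ?_
        rw [Finset.mem_Icc] at hl
        have hsum : (k : ℝ) = l + (k - l : ℕ) := by exact_mod_cast (by omega : k = l + (k - l))
        rw [hsum]
        exact one_div_add_one_div_rpow_le hs (by exact_mod_cast hl.1)
          (by exact_mod_cast (by omega : 2 ≤ k - l))
    _ = (2 * ∑ l ∈ Finset.Icc 2 (k - 2), 1 / (l : ℝ) ^ 2
          + 4 / k * ∑ l ∈ Finset.Icc 2 (k - 2), 1 / (l : ℝ))
          * (2 / (k : ℝ) + 1 / 2) ^ (s - 2) := by
        rw [← Finset.sum_mul, Finset.sum_add_distrib, Finset.sum_add_distrib, ← Finset.mul_sum,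
          Finset.sum_add_distrib, sum_Icc_sub_reflect (fun l => 1 / (l : ℝ) ^ 2) (by omega),
          sum_Icc_sub_reflect (fun l => 1 / (l : ℝ)) (by omega)]
        ring
    _ ≤ (2 * (Real.pi ^ 2 / 6 - 1) + 4 / k * Real.log ((k : ℝ) - 2))
          * (2 / (k : ℝ) + 1 / 2) ^ (s - 2) := by
        gcongr
        exact sum_Icc_two_one_div_sq_le _
    _ = _ := by ring

theorem splitBound_antitoneOn {s : ℝ} (hs : 2 ≤ s) :
    AntitoneOn (splitBound s) (Set.Ici 6) := by
  intro n hn k hk hnk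
  have hlog := log_sub_two_div_antitoneOn hn hk hnk
  have hn6 : (6 : ℝ) ≤ n := by exact_mod_cast hn
  have hnk' : (n : ℝ) ≤ k := by exact_mod_cast hnk
  have hnonneg : 0 ≤ 4 * Real.log ((n : ℝ) - 2) / (n : ℝ) + (Real.pi ^ 2 - 6) / 3 := by
    have := Real.log_nonneg (show (1 : ℝ) ≤ n - 2 by linarith)
    have : 0 ≤ Real.pi ^ 2 - 6 := by nlinarith [Real.pi_gt_three]
    positivity
  have hend : (k : ℝ) / (k - 1) ≤ n / (n - 1) := by
    rw [div_le_div_iff₀ (by linarith) (by linarith)]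
    linarith
  have hbase : 0 ≤ (k : ℝ) / (k - 1) := div_nonneg (by linarith) (by linarith)
  unfold splitBound
  rw [mul_div_assoc, mul_div_assoc] at *
  gcongr

theorem convWeight_add_zetaUp_le_alpha {s : ℝ} (hs : 1 < s) {L : ℕ} (hL : 1 ≤ L) {m k : ℕ}
    (hm : 6 ≤ m) (hk : m ≤ k) : convWeight s k + zetaUp s L ≤ alpha s L m m := by
  have hk0 : k ≠ 0 := by omega
  rw [convWeight_eq s hk0, alpha, if_neg (by omega), if_neg (lt_irrefl _)]
  split_ifs with h2
  · have h := (splitSum_le_splitBound h2 (by omega)).trans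
      (splitBound_antitoneOn h2 hm (hm.trans hk) hk)
    rw [splitBound] at h
    linarith
  · linarith [splitSum_le hs hL hk0]

theorem convWeight_add_zetaUp_le {s : ℝ} (hs : 1 < s) {L : ℕ} (hL : 1 ≤ L) (k : ℕ) :
    convWeight s k + zetaUp s L ≤ 2 + 2 ^ (s - 1) * zetaUp s L + zetaUp s L := by
  have hzeta : 0 ≤ zetaUp s L := (by positivity : (0 : ℝ) ≤ _).trans (two_mul_tsum_le_zetaUp hs hL)
  rcases eq_or_ne k 0 with rfl | hk
  · rw [convWeight_zero]
    have : 0 ≤ 2 ^ (s - 1) * zetaUp s L := by positivity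
    linarith
  · linarith [convWeight_eq s hk, splitSum_le hs hL hk]

/-! ### Geometric sums of inverse weights -/

/-- The sum `∑_{l ≤ k} θ^{k-l} ω_{m+k} / ω_{m+l}` in terms of which the tail of an inverse
tridiagonal operator applied to `1 / ω` is estimated, with the quotient of weights written as in
the constants `D¹`, `D²`. -/
def geomWeight (θ p : ℝ) (m k : ℕ) : ℝ :=
  ∑ l ∈ Finset.range (k + 1), θ ^ (k - l) * (((m : ℝ) + k) / ((m : ℝ) + l)) ^ p

/-- The bound `χ` as a function of the point `x` at which it is evaluated; the constant of the
theorem is its value at `x = M`. -/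
def chiAt (θ p m x : ℝ) : ℝ :=
  θ ^ (x / 2) * (x / 2) * ((m + x) / m) ^ p + θ ^ Real.sqrt x * (x / 2) * (2 : ℝ) ^ p
    + 1 / (1 - θ) * ((m + x) / (m + x - Real.sqrt x - 1)) ^ p

theorem geomConv_one_div_wt (θ p : ℝ) {m : ℕ} (hm : m ≠ 0) (k : ℕ) :
    geomConv θ (fun j => 1 / wt p (m + j)) k = 1 / wt p (m + k) * geomWeight θ p m k := by
  rw [geomConv, geomWeight, Finset.mul_sum]
  refine Finset.sum_congr rfl fun j _ => ?_
  have h := wt_div_wt p (show m + j ≠ 0 by omega) (show m + k ≠ 0 by omega)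
  push_cast at h
  rw [← h, mul_left_comm, one_div_mul_eq_div, div_div_cancel_left' (wt_pos p (m + k)).ne', one_div]

section

variable {θ p : ℝ} (h0 : 0 ≤ θ) (h1 : θ < 1)
include h0 h1

theorem greenSum_le_of_antitone {q : ℕ → ℝ} (hq : ∀ j, 0 ≤ q j) (hanti : Antitone q) (k : ℕ) :
    greenSum θ q k ≤ geomConv θ q k + θ / (1 - θ) * q k := by
  have hterm : ∀ i, θ ^ i * q (k + i) ≤ θ ^ i * q k := fun i =>
    mul_le_mul_of_nonneg_left (hanti (Nat.le_add_right k i)) (pow_nonneg h0 i)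
  have hgeo := (hasSum_geometric_of_lt_one h0 h1).mul_right (q k)
  have htail : ∑' i, θ ^ i * q (k + i) ≤ q k + θ / (1 - θ) * q k :=
    calc ∑' i, θ ^ i * q (k + i)
        ≤ ∑' i, θ ^ i * q k := Summable.tsum_le_tsum hterm
          (hgeo.summable.of_nonneg_of_le (fun i => mul_nonneg (pow_nonneg h0 i) (hq _)) hterm)
          hgeo.summable
      _ = q k + θ / (1 - θ) * q k := by
          have : 1 - θ ≠ 0 := by linarith
          rw [hgeo.tsum_eq]
          field_simp
          ring
  rw [greenSum, geomConv, Finset.sum_range_succ, Nat.sub_self, pow_zero, one_mul]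
  linarith

theorem greenSum_one_div_wt_le (hp : 0 ≤ p) {m : ℕ} (hm : m ≠ 0) (k : ℕ) :
    greenSum θ (fun j => 1 / wt p (m + j)) k
      ≤ 1 / wt p (m + k) * (geomWeight θ p m k + θ / (1 - θ)) := by
  refine (greenSum_le_of_antitone h0 h1 (fun j => one_div_nonneg.2 (wt_pos _ _).le)
    (fun i j hij => one_div_le_one_div_of_le (wt_pos _ _) (wt_mono hp (by omega))) k).trans_eq ?_
  rw [geomConv_one_div_wt θ p hm]
  ring

theorem greenSum_one_div_wt_zero_le (hp : 0 ≤ p) {m : ℕ} (hm : m ≠ 0) :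
    greenSum θ (fun j => 1 / wt p (m + j)) 0 ≤ 1 / (wt p m * (1 - θ)) := by
  refine (greenSum_one_div_wt_le h0 h1 hp hm 0).trans_eq ?_
  have : 1 - θ ≠ 0 := by linarith
  have hw : geomWeight θ p m 0 = 1 := by simp [geomWeight, hm]
  have := (wt_pos p m).ne'
  rw [hw, add_zero]
  field_simp
  ring

end

theorem summable_pow_mul_one_add_rpow {θ : ℝ} (h0 : 0 < θ) (h1 : θ < 1) (p : ℝ) :
    Summable fun n : ℕ => θ ^ n * (1 + (n : ℝ)) ^ p := by
  obtain ⟨N, hN⟩ := exists_nat_ge p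
  have hpoly : Summable fun n : ℕ => ((n + 1 : ℕ) : ℝ) ^ N * θ ^ (n + 1) :=
    (summable_nat_add_iff (f := fun n : ℕ => (n : ℝ) ^ N * θ ^ n) 1).2
      (summable_pow_mul_geometric_of_norm_lt_one N (by rwa [Real.norm_of_nonneg h0.le]))
  refine Summable.of_nonneg_of_le (fun n => by positivity) (fun n => ?_) (hpoly.mul_left θ⁻¹)
  calc θ ^ n * (1 + (n : ℝ)) ^ p
      ≤ θ ^ n * (1 + (n : ℝ)) ^ (N : ℝ) := by
        gcongr
        linarith [Nat.cast_nonneg (α := ℝ) n]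
    _ = θ⁻¹ * (((n + 1 : ℕ) : ℝ) ^ N * θ ^ (n + 1)) := by
        rw [Real.rpow_natCast, pow_succ]
        field_simp
        push_cast
        ring

theorem geomWeight_le_tsum {θ p : ℝ} (h0 : 0 < θ) (h1 : θ < 1) (hp : 0 ≤ p) {m : ℕ}
    (hm : 1 ≤ m) (k : ℕ) :
    geomWeight θ p m k ≤ ∑' n : ℕ, θ ^ n * (1 + (n : ℝ)) ^ p := by
  have hm' : (1 : ℝ) ≤ m := by exact_mod_cast hm
  refine le_trans ?_ ((summable_pow_mul_one_add_rpow h0 h1 p).sum_le_tsum (Finset.range (k + 1))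
    fun _ _ => by positivity)
  rw [geomWeight, ← Finset.sum_range_reflect]
  refine Finset.sum_le_sum fun n hn => ?_
  obtain ⟨l, rfl⟩ := Nat.exists_eq_add_of_le' (Nat.lt_succ_iff.1 (Finset.mem_range.1 hn))
  rw [show l + n + 1 - 1 - n = l by omega, show l + n - l = n by omega]
  gcongr
  rw [div_le_iff₀ (by positivity)]
  push_cast
  nlinarith [mul_nonneg (Nat.cast_nonneg (α := ℝ) n) (show (0 : ℝ) ≤ m + l - 1 by
    linarith [Nat.cast_nonneg (α := ℝ) l])]

/-! ### The constant `χ` -/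

section

variable {θ p : ℝ}

theorem pow_mul_div_rpow_le (h0 : 0 < θ) (h1 : θ ≤ 1) (hp : 0 ≤ p) {m k l : ℕ} (hlk : l ≤ k)
    {x c : ℝ} (hx : x + l ≤ k) (hc : 0 < c) (hcl : c ≤ m + l) :
    θ ^ (k - l) * (((m : ℝ) + k) / ((m : ℝ) + l)) ^ p ≤ θ ^ x * (((m : ℝ) + k) / c) ^ p := by
  have hpow : θ ^ (k - l) ≤ θ ^ x := by
    rw [← Real.rpow_natCast, Nat.cast_sub hlk]
    exact Real.rpow_le_rpow_of_exponent_ge h0 h1 (by linarith)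
  gcongr

theorem sum_pow_sub_le (h0 : 0 ≤ θ) (h1 : θ < 1) (N : ℕ) :
    ∑ i ∈ Finset.range N, θ ^ (N - 1 - i) ≤ 1 / (1 - θ) := by
  rw [Finset.sum_range_reflect (fun i => θ ^ i) N, one_div, ← tsum_geometric_of_lt_one h0 h1]
  exact (summable_geometric_of_lt_one h0 h1).sum_le_tsum _ fun _ _ => by positivity

theorem sum_pow_mul_rpow_last_le (h0 : 0 < θ) (h1 : θ < 1) (hp : 0 ≤ p) {m k a N : ℕ} {u : ℝ}
    (hk : k + 1 = a + N) (hu : 0 < (m : ℝ) + k - u - 1) (hN : (N : ℝ) ≤ u + 1) :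
    ∑ i ∈ Finset.range N, θ ^ (k - (a + i)) * (((m : ℝ) + k) / ((m : ℝ) + (a + i : ℕ))) ^ p
      ≤ 1 / (1 - θ) * (((m : ℝ) + k) / ((m : ℝ) + k - u - 1)) ^ p := by
  have hk' : (k : ℝ) + 1 = a + N := by exact_mod_cast hk
  have hterm : ∀ i ∈ Finset.range N,
      θ ^ (k - (a + i)) * (((m : ℝ) + k) / ((m : ℝ) + (a + i : ℕ))) ^ p
        ≤ θ ^ (N - 1 - i) * (((m : ℝ) + k) / ((m : ℝ) + k - u - 1)) ^ p := fun i hi => by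
    have hi' := Finset.mem_range.1 hi
    rw [← Real.rpow_natCast θ (N - 1 - i), show N - 1 - i = k - (a + i) by omega]
    refine pow_mul_div_rpow_le h0 h1.le hp (by omega) ?_ hu ?_
    · rw [Nat.cast_sub (by omega), sub_add_cancel]
    · push_cast
      linarith [Nat.cast_nonneg (α := ℝ) i]
  refine (Finset.sum_le_sum hterm).trans ?_
  rw [← Finset.sum_mul]
  gcongr
  exact sum_pow_sub_le h0.le h1 N

theorem exists_block_lengths {k : ℕ} (hk : 4 ≤ k) : ∃ n r N : ℕ, k + 1 = n + r + N ∧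
    k ≤ 2 * n + 1 ∧ 2 * n ≤ k ∧ 2 * r ≤ k ∧ Real.sqrt k ≤ N ∧ (N : ℝ) ≤ Real.sqrt k + 1 := by
  have hk' : (4 : ℝ) ≤ k := by exact_mod_cast hk
  have hsq : Real.sqrt k * Real.sqrt k = k := Real.mul_self_sqrt (by linarith)
  have h2 : 2 ≤ Real.sqrt k := Real.le_sqrt_of_sq_le (by linarith)
  have hle := Nat.le_ceil (Real.sqrt k)
  have hlt := Nat.ceil_lt_add_one (Real.sqrt_nonneg k)
  have hN2 : 2 ≤ ⌈Real.sqrt k⌉₊ := by exact_mod_cast h2.trans hle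
  have hfit : ⌈Real.sqrt k⌉₊ + k / 2 < k + 1 := by
    have hhalf : ((k / 2 : ℕ) : ℝ) ≤ k / 2 := Nat.cast_div_le
    have : (⌈Real.sqrt k⌉₊ : ℝ) + (k / 2 : ℕ) < k + 1 := by nlinarith
    exact_mod_cast this
  exact ⟨k / 2, k + 1 - ⌈Real.sqrt k⌉₊ - k / 2, ⌈Real.sqrt k⌉₊, by omega, by omega, by omega,
    by omega, hle, hlt.le⟩

-- The three terms of `χ` bound the blocks `l < k/2`, `k/2 ≤ l ≤ k - √k` and `k - √k < l ≤ k`.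
theorem geomWeight_le_chiAt (h0 : 0 < θ) (h1 : θ < 1) (hp : 0 ≤ p) {m k : ℕ} (hm : 1 ≤ m)
    (hk : 4 ≤ k) : geomWeight θ p m k ≤ chiAt θ p m k := by
  have hm1 : (1 : ℝ) ≤ m := by exact_mod_cast hm
  have hk4 : (4 : ℝ) ≤ k := by exact_mod_cast hk
  obtain ⟨n, r, N, hsplit, hkn, hnk, hrk, hNu, hNu'⟩ := exists_block_lengths hk
  have hsplit' : (k : ℝ) + 1 = n + r + N := by exact_mod_cast hsplit
  have hkn' : (k : ℝ) ≤ 2 * n + 1 := by exact_mod_cast hkn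
  have hnk' : 2 * (n : ℝ) ≤ k := by exact_mod_cast hnk
  have hrk' : 2 * (r : ℝ) ≤ k := by exact_mod_cast hrk
  set u := Real.sqrt k
  have hu : u * u = k := Real.mul_self_sqrt (by linarith)
  rw [geomWeight, chiAt, hsplit, Finset.sum_range_add, Finset.sum_range_add]
  refine add_le_add (add_le_add ?_ ?_) ?_
  · have hblock : ∀ l ∈ Finset.range n, θ ^ (k - l) * (((m : ℝ) + k) / ((m : ℝ) + l)) ^ p
        ≤ θ ^ ((k : ℝ) / 2) * (((m : ℝ) + k) / m) ^ p := fun l hl => by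
      have hl' := Finset.mem_range.1 hl
      have hln : (l : ℝ) ≤ n := by exact_mod_cast hl'.le
      exact pow_mul_div_rpow_le h0 h1.le hp (by omega) (by linarith) (by linarith) (by simp)
    refine (Finset.sum_le_card_nsmul _ _ _ hblock).trans ?_
    rw [Finset.card_range, nsmul_eq_mul, mul_right_comm, mul_comm]
    gcongr
    linarith
  · have hblock : ∀ i ∈ Finset.range r,
        θ ^ (k - (n + i)) * (((m : ℝ) + k) / ((m : ℝ) + (n + i : ℕ))) ^ p
          ≤ θ ^ u * (((m : ℝ) + k) / (((m : ℝ) + k) / 2)) ^ p := fun i hi => by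
      have hi' := Finset.mem_range.1 hi
      have hiN : ((n + i : ℕ) : ℝ) + N ≤ k := by exact_mod_cast (by omega : n + i + N ≤ k)
      refine pow_mul_div_rpow_le h0 h1.le hp (by omega) (by linarith) (by positivity) ?_
      push_cast
      linarith [Nat.cast_nonneg (α := ℝ) i]
    refine (Finset.sum_le_card_nsmul _ _ _ hblock).trans ?_
    rw [Finset.card_range, nsmul_eq_mul, div_div_cancel₀ (by positivity), mul_right_comm, mul_comm]
    gcongr
    linarith
  · exact sum_pow_mul_rpow_last_le h0 h1 hp (by omega) (by nlinarith [hu]) hNu'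

theorem exp_mul_rpow_le (hp : 0 ≤ p) {a c x y : ℝ} (hyx : y ≤ x) (hy : 0 < c + y)
    (hpa : p ≤ a * (c + y)) :
    Real.exp (-(a * x)) * (c + x) ^ p ≤ Real.exp (-(a * y)) * (c + y) ^ p := by
  set r := (c + x) / (c + y) with hr
  have hr0 : 0 ≤ r := div_nonneg (by linarith) hy.le
  have hsplit : c + x = (c + y) * r := by rw [hr]; field_simp
  have hrp : r ^ p ≤ Real.exp (a * (x - y)) :=
    calc r ^ p ≤ Real.exp (r - 1) ^ p := by
          gcongr
          linarith [Real.add_one_le_exp (r - 1)]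
      _ = Real.exp (p * ((x - y) / (c + y))) := by
          rw [← Real.exp_mul, hr]
          congr 1
          field_simp
          ring
      _ ≤ Real.exp (a * (x - y)) := by
          rw [Real.exp_le_exp, mul_div_assoc', div_le_iff₀ hy]
          nlinarith
  rw [hsplit, Real.mul_rpow hy.le hr0]
  calc Real.exp (-(a * x)) * ((c + y) ^ p * r ^ p)
      ≤ Real.exp (-(a * x)) * ((c + y) ^ p * Real.exp (a * (x - y))) := by gcongr
    _ = Real.exp (-(a * y)) * (c + y) ^ p := by
        rw [mul_left_comm, ← Real.exp_add, mul_comm]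
        ring_nf

theorem rpow_mul_rpow_le (h0 : 0 < θ) (hp : 0 ≤ p) {c x y : ℝ} (hyx : y ≤ x) (hy : 0 < c + y)
    (hpθ : p ≤ -Real.log θ * (c + y)) : θ ^ x * (c + x) ^ p ≤ θ ^ y * (c + y) ^ p := by
  have h := exp_mul_rpow_le hp hyx hy hpθ
  simpa only [neg_mul, neg_neg, ← Real.rpow_def_of_pos h0] using h

theorem pow_le_pow_mul_wt_div_wt (h0 : 0 < θ) (hp : 0 ≤ p) {m M k : ℕ} (hm : m ≠ 0)
    (hM : p ≤ -Real.log θ * (m + M)) (hk : M ≤ k) :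
    θ ^ k ≤ θ ^ M * wt p (m + M) / wt p (m + k) := by
  have h := rpow_mul_rpow_le h0 hp (Nat.cast_le (α := ℝ).2 hk) (by positivity) hM
  rw [le_div_iff₀ (wt_pos _ _), wt_of_ne_zero p (by omega), wt_of_ne_zero p (by omega)]
  exact_mod_cast h

theorem chiAt_fst_antitone (h0 : 0 < θ) (hp : 0 ≤ p) {m x y : ℝ} (hm : 0 < m) (hy : 0 < y)
    (hpy : p / (m + y) + 1 / y ≤ -Real.log θ / 2) (hyx : y ≤ x) :
    θ ^ (x / 2) * (x / 2) * ((m + x) / m) ^ p ≤ θ ^ (y / 2) * (y / 2) * ((m + y) / m) ^ p := by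
  have hfactor : ∀ z, 0 < z → θ ^ (z / 2) * (z / 2) * ((m + z) / m) ^ p
      = Real.exp (-(1 / y * z)) * (0 + z) ^ (1 : ℝ)
        * (Real.exp (-((-Real.log θ / 2 - 1 / y) * z)) * (m + z) ^ p) / (2 * m ^ p) :=
      fun z hz => by
    rw [Real.div_rpow (by positivity) hm.le, Real.rpow_one, zero_add, Real.rpow_def_of_pos h0,
      show Real.log θ * (z / 2) = -(1 / y * z) + -((-Real.log θ / 2 - 1 / y) * z) by ring,
      Real.exp_add]
    ring
  have hlinear := exp_mul_rpow_le zero_le_one hyx (c := 0) (by linarith)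
    (show (1 : ℝ) ≤ 1 / y * (0 + y) by rw [zero_add, one_div_mul_cancel hy.ne'])
  have hpower := exp_mul_rpow_le hp hyx (show 0 < m + y by positivity)
    ((div_le_iff₀ (by positivity)).1 (le_sub_iff_add_le.2 hpy))
  have hx : 0 < x := hy.trans_le hyx
  rw [hfactor x hx, hfactor y hy]
  gcongr

theorem chiAt_snd_antitone (h0 : 0 < θ) {x y : ℝ} (hy : 0 < y)
    (hθy : 2 ≤ -Real.log θ * Real.sqrt y) (hyx : y ≤ x) :
    θ ^ Real.sqrt x * (x / 2) ≤ θ ^ Real.sqrt y * (y / 2) := by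
  have h := rpow_mul_rpow_le h0 zero_le_two (Real.sqrt_le_sqrt hyx) (c := 0)
    (by simpa using hy) (by simpa using hθy)
  rw [zero_add, zero_add, Real.rpow_two, Real.rpow_two, Real.sq_sqrt (by linarith),
    Real.sq_sqrt hy.le] at h
  linarith

theorem div_sub_sqrt_sub_one_antitone {m x y : ℝ} (hm : 1 ≤ m) (hy : 1 < y) (hmy : m ≤ y)
    (hyx : y ≤ x) : (m + x) / (m + x - Real.sqrt x - 1) ≤ (m + y) / (m + y - Real.sqrt y - 1) := by
  obtain ⟨v, hv, rfl⟩ : ∃ v, 1 < v ∧ v ^ 2 = y :=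
    ⟨Real.sqrt y, Real.lt_sqrt_of_sq_lt (by linarith), Real.sq_sqrt (by linarith)⟩
  obtain ⟨u, hu, rfl⟩ : ∃ u, v ≤ u ∧ u ^ 2 = x :=
    ⟨Real.sqrt x, Real.le_sqrt_of_sq_le hyx, Real.sq_sqrt (by linarith)⟩
  rw [Real.sqrt_sq (by linarith), Real.sqrt_sq (by linarith),
    div_le_div_iff₀ (by nlinarith) (by nlinarith)]
  have hle : 0 ≤ u * v + u + v - m := by nlinarith
  linarith [mul_nonneg (sub_nonneg.2 hu) hle]

theorem chiAt_antitone (h0 : 0 < θ) (h1 : θ < 1) (hp : 0 ≤ p) {m x y : ℝ} (hm : 1 ≤ m)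
    (hy : 1 < y) (hmy : m ≤ y) (hpy : p / (m + y) + 1 / y ≤ -Real.log θ / 2)
    (hθy : 2 ≤ -Real.log θ * Real.sqrt y) (hyx : y ≤ x) : chiAt θ p m x ≤ chiAt θ p m y := by
  have hden : 0 ≤ m + x - Real.sqrt x - 1 := by
    nlinarith [Real.mul_self_sqrt (show 0 ≤ x by linarith), Real.sqrt_nonneg x,
      Real.one_le_sqrt.2 (hy.le.trans hyx)]
  refine add_le_add (add_le_add ?_ ?_) ?_
  · exact chiAt_fst_antitone h0 hp (by linarith) (by linarith) hpy hyx
  · exact mul_le_mul_of_nonneg_right (chiAt_snd_antitone h0 (by linarith) hθy hyx) (by positivity)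
  · exact mul_le_mul_of_nonneg_left (Real.rpow_le_rpow (div_nonneg (by linarith) hden)
      (div_sub_sqrt_sub_one_antitone hm hy hmy hyx) hp) (by rw [one_div_nonneg]; linarith)

end

theorem quadratic_nonpos_of_root_le {a b c x : ℝ} (ha : a < 0)
    (h : (-b - Real.sqrt (b ^ 2 - 4 * a * c)) / (2 * a) ≤ x) : a * x ^ 2 + b * x + c ≤ 0 := by
  rw [div_le_iff_of_neg (by linarith)] at h
  have hsq := (Real.sqrt_le_iff.1 (show Real.sqrt (b ^ 2 - 4 * a * c) ≤ -b - x * (2 * a) by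
    linarith)).2
  nlinarith

namespace Data

variable {P : Data}

theorem CondMA.m_le_M (hMA : P.CondMA) : P.m ≤ P.M := by
  exact_mod_cast (le_max_right _ _).trans hMA

theorem SmallRatio.log_θ_neg (H : P.SmallRatio) : Real.log P.θ < 0 :=
  Real.log_neg H.θ_pos H.θ_lt_one

theorem SmallRatio.s_le (H : P.SmallRatio) (hMY : P.CondMY) :
    P.s ≤ -Real.log P.θ * ((P.m : ℝ) + P.M) := by
  have h := (le_max_left _ _).trans hMY
  have hroot : -P.s / Real.log P.θ ≤ P.m + P.M := by linarith
  rw [div_le_iff_of_neg H.log_θ_neg] at hroot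
  linarith

theorem SmallRatio.two_le_neg_log_θ_mul_sqrt (H : P.SmallRatio) (hMA : P.CondMA) :
    2 ≤ -Real.log P.θ * Real.sqrt P.M := by
  have hl := H.log_θ_neg
  have h := ((le_max_right _ _).trans (le_max_left _ _)).trans hMA
  rw [div_le_iff₀ (sq_pos_of_neg hl)] at h
  refine le_of_sq_le_sq ?_ (mul_nonneg (by linarith) (Real.sqrt_nonneg _))
  rw [mul_pow, Real.sq_sqrt (Nat.cast_nonneg _), neg_sq]
  linarith

theorem SmallRatio.div_add_one_div_le (H : P.SmallRatio) (hMA : P.CondMA) :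
    (P.s + P.sL) / ((P.m : ℝ) + P.M) + 1 / P.M ≤ -Real.log P.θ / 2 := by
  have hm : (0 : ℝ) < P.m := by exact_mod_cast P.m_pos
  have hM : (0 : ℝ) < P.M := by exact_mod_cast P.m_pos.trans_le hMA.m_le_M
  have h := ((le_max_left _ _).trans (le_max_left _ _)).trans hMA
  rw [Real.log_sqrt H.θ_pos.le] at h
  have hquad := quadratic_nonpos_of_root_le (x := P.M)
    (b := (P.m : ℝ) * (Real.log P.θ / 2) + P.s + P.sL + 1) (c := P.m)
    (div_neg_of_neg_of_pos H.log_θ_neg two_pos) (h.trans' (by ring_nf; rfl))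
  rw [div_add_div _ _ (by positivity) hM.ne', div_le_iff₀ (by positivity)]
  linarith

theorem SmallRatio.geomWeight_le_χ (H : P.SmallRatio) (hp : 0 ≤ P.s + P.sL) (hm : 6 ≤ P.m)
    (hMA : P.CondMA) {k : ℕ} (hk : P.M ≤ k) : geomWeight P.θ (P.s + P.sL) P.m k ≤ P.χ := by
  have hmM := hMA.m_le_M
  have hM : 1 < P.M := by omega
  exact (geomWeight_le_chiAt H.θ_pos H.θ_lt_one hp P.m_pos (by omega)).trans
    (chiAt_antitone H.θ_pos H.θ_lt_one hp (by exact_mod_cast P.m_pos) (by exact_mod_cast hM)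
      (by exact_mod_cast hmM) (H.div_add_one_div_le hMA) (H.two_le_neg_log_θ_mul_sqrt hMA)
      (by exact_mod_cast hk))

end Data

/-! ### Bounded maps between the spaces `Ω^s` -/

namespace Omega

theorem add_apply {s : ℝ} (x y : Omega s) (k : ℕ) : (x + y) k = x k + y k := rfl

theorem sub_apply {s : ℝ} (x y : Omega s) (k : ℕ) : (x - y) k = x k - y k := rfl

theorem smul_apply {s : ℝ} (c : ℝ) (x : Omega s) (k : ℕ) : (c • x) k = c * x k := rfl

theorem ext {s : ℝ} {x y : Omega s} (h : ∀ k, x k = y k) : x = y := Subtype.ext (funext h)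

/-- The continuous linear map into `Ω^s` given by a linear map into sequences that is bounded in
the weighted norm. -/
def mkCLM {E : Type*} [NormedAddCommGroup E] [NormedSpace ℝ E] {s : ℝ}
    (F : E →ₗ[ℝ] (ℕ → ℝ)) (C : ℝ) (hC : ∀ x k, |F x k| * wt s k ≤ C * ‖x‖) : E →L[ℝ] Omega s :=
  LinearMap.mkContinuous
    { toFun := fun x => ⟨F x, ⟨C * ‖x‖, by rintro _ ⟨k, rfl⟩; exact hC x k⟩⟩
      map_add' := fun x y => ext fun k => congrFun (F.map_add x y) k
      map_smul' := fun c x => ext fun k => congrFun (F.map_smul c x) k }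
    C fun x => norm_le _ (hC x)

/-- The inclusion `Ω^s ⊆ Ω^t` for `t ≤ s`, as a continuous linear map. -/
def inclusion {s t : ℝ} (hts : t ≤ s) : Omega s →L[ℝ] Omega t :=
  mkCLM (omegaSubmodule s).subtype 1 fun x k =>
    (mul_le_mul_of_nonneg_left (wt_exponent_mono k hts) (abs_nonneg _)).trans <| by
      rw [one_mul]
      exact x.le_norm k

/-- The coordinate functional `x ↦ x_k`. -/
def eval (s : ℝ) (k : ℕ) : Omega s →L[ℝ] ℝ :=
  LinearMap.mkContinuous
    { toFun := fun x => x k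
      map_add' := fun _ _ => rfl
      map_smul' := fun _ _ => rfl }
    (1 / wt s k) fun x => by
      rw [one_div_mul_eq_div]
      exact x.abs_le k

/-- The finite part `x ↦ x_F` as a continuous linear map. -/
def finCLM (s : ℝ) (m : ℕ) : Omega s →L[ℝ] (Fin m → ℝ) :=
  ContinuousLinearMap.pi fun i => eval s i

end Omega

theorem extend_of_lt {m : ℕ} (u : Fin m → ℝ) {k : ℕ} (h : k < m) : extend u k = u ⟨k, h⟩ :=
  dif_pos h

theorem extend_of_le {m : ℕ} (u : Fin m → ℝ) {k : ℕ} (h : m ≤ k) : extend u k = 0 :=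
  dif_neg h.not_gt

/-- Extension by zero as a continuous linear map. -/
def extendCLM (s : ℝ) (m : ℕ) : (Fin m → ℝ) →L[ℝ] Omega s :=
  LinearMap.toContinuousLinearMap
    { toFun := fun u => ⟨extend u, extend_mem s u⟩
      map_add' := fun u v => Omega.ext fun k => by
        change extend (u + v) k = extend u k + extend v k
        unfold extend
        split_ifs <;> simp
      map_smul' := fun c u => Omega.ext fun k => by
        change extend (c • u) k = c * extend u k
        unfold extend
        split_ifs <;> simp }

theorem conv_add_left {s : ℝ} (hs : 1 < s) (x y z : Omega s) (k : ℕ) :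
    conv (x + y : Omega s) z k = conv x z k + conv y z k := by
  rw [conv_comm, conv_add_right hs, conv_comm z x, conv_comm z y]

theorem conv_smul_left (x y : ℕ → ℝ) (c : ℝ) (k : ℕ) : conv (c • x) y k = c * conv x y k := by
  rw [conv_comm, conv_smul_right, conv_comm y x]

theorem abs_conv_mul_wt_le {s : ℝ} (hs : 1 < s) (x y : Omega s) (k : ℕ) :
    |conv x y k| * wt s k ≤ (2 + 2 ^ (s - 1) * zetaUp s 1 + zetaUp s 1) * ‖x‖ * ‖y‖ := by
  rw [← le_div_iff₀ (wt_pos s k)]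
  refine (abs_conv_le hs le_rfl x y k).trans ?_
  refine div_le_div_of_nonneg_right ?_ (wt_pos s k).le
  refine mul_le_mul_of_nonneg_right ?_ (norm_nonneg y)
  refine mul_le_mul_of_nonneg_right ?_ (norm_nonneg x)
  exact convWeight_add_zetaUp_le hs le_rfl k

/-- The convolution as a bounded bilinear map `Ω^s × Ω^s → Ω^s`. -/
def convCLM {s : ℝ} (hs : 1 < s) : Omega s →L[ℝ] Omega s →L[ℝ] Omega s :=
  LinearMap.mkContinuous₂
    (LinearMap.mk₂ ℝ
      (fun x y => ⟨conv x y, ⟨_, by rintro _ ⟨k, rfl⟩; exact abs_conv_mul_wt_le hs x y k⟩⟩)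
      (fun x y z => Omega.ext fun k => conv_add_left hs x y z k)
      (fun c x y => Omega.ext fun k => conv_smul_left x y c k)
      (fun x y z => Omega.ext fun k => conv_add_right hs x y z k)
      (fun c x y => Omega.ext fun k => conv_smul_right x y c k))
    _ fun x y => Omega.norm_le _ (abs_conv_mul_wt_le hs x y)

namespace Data

variable {P : Data} {C₂ : ℝ}

/-- A diagonally dominant tail whose diagonal grows at least like `C₁ ω_k^{s_L}`, which makes the
tail inverse gain `s_L` in the weight. -/
structure TailElliptic (P : Data) : Prop extends TailDominant P where
  C₁_pos : 0 < P.C₁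
  le_mu : ∀ k, P.m ≤ k → P.C₁ * wt P.sL k ≤ |P.mu k|

/-- The assumptions under which `f` maps `Ω^s` to `Ω^{s - s_L}` and `A` maps back. -/
structure Regular (P : Data) (C₂ : ℝ) : Prop extends TailElliptic P where
  one_lt_s : 1 < P.s
  sL_nonneg : 0 ≤ P.sL
  abs_lam_le : ∀ k, |P.lam k| ≤ C₂ * wt P.sL k
  abs_mu_le : ∀ k, |P.mu k| ≤ C₂ * wt P.sL k
  abs_beta_le : ∀ k, |P.beta k| ≤ C₂ * wt P.sL k

theorem lin_eq (P : Data) (x : ℕ → ℝ) (k : ℕ) :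
    P.lin x k = (if k = 0 then 0 else P.lam k * x (k - 1)) + P.mu k * x k
      + P.beta k * x (k + 1) := by
  cases k <;> simp [lin]

namespace Regular

variable (H : P.Regular C₂)
include H

theorem s_pos : 0 < P.s := one_pos.trans H.one_lt_s

theorem C₂_nonneg : 0 ≤ C₂ := by
  simpa using (abs_nonneg _).trans (H.abs_mu_le 0)

theorem abs_mul_apply_mul_wt_le (x : Omega P.s) {a : ℝ} {j k : ℕ} (ha : |a| ≤ C₂ * wt P.sL k)
    (hkj : k ≤ j + 1) : |a * x j| * wt (P.s - P.sL) k ≤ C₂ * 2 ^ P.s * ‖x‖ := by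
  have hC := H.C₂_nonneg
  have hwt := wt_pos (P.s - P.sL) k
  have hsplit : wt P.s k = wt P.sL k * wt (P.s - P.sL) k := by rw [← wt_add, add_sub_cancel]
  have hshift := (wt_mono H.s_pos.le hkj).trans (wt_succ_le H.s_pos.le j)
  calc |a * x j| * wt (P.s - P.sL) k
      ≤ C₂ * wt P.sL k * |x j| * wt (P.s - P.sL) k := by rw [abs_mul]; gcongr
    _ = C₂ * |x j| * wt P.s k := by rw [hsplit]; ring
    _ ≤ C₂ * |x j| * (2 ^ P.s * wt P.s j) := by gcongr
    _ = C₂ * 2 ^ P.s * (|x j| * wt P.s j) := by ring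
    _ ≤ C₂ * 2 ^ P.s * ‖x‖ := by gcongr; exact x.le_norm j

theorem abs_lin_mul_wt_le (x : Omega P.s) (k : ℕ) :
    |P.lin x k| * wt (P.s - P.sL) k ≤ 3 * (C₂ * 2 ^ P.s) * ‖x‖ := by
  have hsub : |if k = 0 then 0 else P.lam k * x (k - 1)| * wt (P.s - P.sL) k
      ≤ C₂ * 2 ^ P.s * ‖x‖ := by
    split_ifs
    · have hC := H.C₂_nonneg
      rw [abs_zero, zero_mul]
      positivity
    · exact H.abs_mul_apply_mul_wt_le x (H.abs_lam_le k) (by omega)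
  have hdiag := H.abs_mul_apply_mul_wt_le x (H.abs_mu_le k) k.le_succ
  have hsuper := H.abs_mul_apply_mul_wt_le x (j := k + 1) (H.abs_beta_le k) (by omega)
  rw [lin_eq]
  have htri := mul_le_mul_of_nonneg_right
    (abs_add_three (if k = 0 then 0 else P.lam k * x (k - 1)) (P.mu k * x k)
      (P.beta k * x (k + 1))) (wt_pos (P.s - P.sL) k).le
  linarith

/-- The tridiagonal operator as a bounded map `𝓛 : Ω^s → Ω^{s - s_L}`. -/
def linCLM : Omega P.s →L[ℝ] Omega (P.s - P.sL) :=
  Omega.mkCLM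
    { toFun := fun x => P.lin x
      map_add' := fun x y => funext fun k => by
        simp only [lin_eq, Omega.add_apply, Pi.add_apply]
        split_ifs <;> ring
      map_smul' := fun c x => funext fun k => by
        simp only [lin_eq, Omega.smul_apply, Pi.smul_apply, smul_eq_mul, RingHom.id_apply]
        split_ifs <;> ring }
    _ H.abs_lin_mul_wt_le

end Regular

end Data

/-! ### The approximate inverse as a bounded map -/

namespace Data

variable {P : Data} {C₂ : ℝ}

theorem b_succ (P : Data) (j : ℕ) : P.b (j + 1) = P.mu (P.m + j) := rfl

namespace TailElliptic

variable (H : P.TailElliptic)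
include H

theorem abs_div_b_le {t C : ℝ} (hC : 0 ≤ C) {y : ℕ → ℝ}
    (hy : ∀ j, |y j| ≤ C / wt t (P.m + j)) (j : ℕ) :
    |y j / P.b (j + 1)| ≤ C / P.C₁ * (1 / wt (t + P.sL) (P.m + j)) := by
  have hwt := wt_pos t (P.m + j)
  have hwtL := wt_pos P.sL (P.m + j)
  have hC₁ := H.C₁_pos
  rw [b_succ, abs_div, wt_add]
  calc |y j| / |P.mu (P.m + j)| ≤ C / wt t (P.m + j) / (P.C₁ * wt P.sL (P.m + j)) :=
        div_le_div₀ (by positivity) (hy j) (by positivity) (H.le_mu _ (Nat.le_add_right _ _))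
    _ = C / P.C₁ * (1 / (wt t (P.m + j) * wt P.sL (P.m + j))) := by field_simp

theorem abs_div_b_le_div_C₁ {t C : ℝ} (ht : 0 ≤ t + P.sL) (hC : 0 ≤ C) {y : ℕ → ℝ}
    (hy : ∀ j, |y j| ≤ C / wt t (P.m + j)) (j : ℕ) : |y j / P.b (j + 1)| ≤ C / P.C₁ :=
  (H.abs_div_b_le hC hy j).trans <| mul_le_of_le_one_right (div_nonneg hC H.C₁_pos.le)
    (div_le_one_of_le₀ (one_le_wt ht _) (wt_pos _ _).le)

theorem abs_tailInv_le_greenSum {t C : ℝ} (ht : 0 ≤ t + P.sL) (hC : 0 ≤ C) {y : ℕ → ℝ}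
    (hy : ∀ j, |y j| ≤ C / wt t (P.m + j)) (k : ℕ) :
    |P.tailInv y k|
      ≤ P.η * (C / P.C₁ * greenSum P.θ (fun j => 1 / wt (t + P.sL) (P.m + j)) k) := by
  refine (H.abs_tailInv_le (H.abs_div_b_le_div_C₁ ht hC hy) k).trans
    (mul_le_mul_of_nonneg_left ?_ H.η_pos.le)
  rw [← greenSum_const_mul]
  exact greenSum_mono H.θ_pos.le H.θ_lt_one (fun j => abs_nonneg _) (H.abs_div_b_le hC hy)
    (fun j => mul_le_of_le_one_right (div_nonneg hC H.C₁_pos.le)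
      (div_le_one_of_le₀ (one_le_wt ht _) (wt_pos _ _).le)) k

end TailElliptic

/-- The sequence `(0, …, 0, 𝓣⁻¹ y_I)` with `m` leading zeros. -/
def tailSeq (P : Data) (y : ℕ → ℝ) (k : ℕ) : ℝ :=
  if k < P.m then 0 else P.tailInv (infPart P.m y) (k - P.m)

theorem tailSeq_of_lt (y : ℕ → ℝ) {k : ℕ} (hk : k < P.m) : P.tailSeq y k = 0 := if_pos hk

theorem tailSeq_add_left (P : Data) (y : ℕ → ℝ) (k : ℕ) :
    P.tailSeq y (P.m + k) = P.tailInv (infPart P.m y) k := by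
  simp [tailSeq]

/-- The unit vector `e_m`, whose tail is `(1, 0, 0, …)`. -/
def unitTail (P : Data) : Omega (P.s - P.sL) :=
  extendCLM _ (P.m + 1) (Pi.single (Fin.last P.m) 1)

theorem infPart_unitTail (P : Data) : infPart P.m P.unitTail = Pi.single 0 1 := by
  funext k
  change extend (Pi.single (Fin.last P.m) (1 : ℝ)) (P.m + k) = _
  rcases k with _ | k
  · rw [extend_of_lt _ (show P.m + 0 < P.m + 1 from Nat.lt_succ_self _)]
    exact Pi.single_eq_same _ _
  · rw [extend_of_le _ (by omega), Pi.single_eq_of_ne k.succ_ne_zero]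

/-- The map `y ↦ A_m y_F`. -/
def amCLM (P : Data) : Omega (P.s - P.sL) →L[ℝ] (Fin P.m → ℝ) :=
  (LinearMap.toContinuousLinearMap (Matrix.toLin' P.Am)).comp (Omega.finCLM _ P.m)

namespace Regular

variable (H : P.Regular C₂)
include H

theorem abs_infPart_div_b_le (y : Omega (P.s - P.sL)) (j : ℕ) :
    |infPart P.m y j / P.b (j + 1)| ≤ ‖y‖ / P.C₁ :=
  H.abs_div_b_le_div_C₁ (by linarith [H.s_pos]) (norm_nonneg y) (fun _ => y.abs_le _) j

theorem abs_tailSeq_mul_wt_le (y : Omega (P.s - P.sL)) (k : ℕ) :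
    |P.tailSeq y k| * wt P.s k ≤ P.η / P.C₁ *
      (∑' n : ℕ, P.θ ^ n * (1 + (n : ℝ)) ^ P.s + P.θ / (1 - P.θ)) * ‖y‖ := by
  have hη := H.η_pos
  have hC₁ := H.C₁_pos
  have hθ := H.θ_pos
  have hθ' := H.one_sub_θ_pos
  set G := ∑' n : ℕ, P.θ ^ n * (1 + (n : ℝ)) ^ P.s
  have hG : 0 ≤ G := tsum_nonneg fun n => by positivity
  rcases lt_or_ge k P.m with hk | hk
  · rw [tailSeq_of_lt y hk, abs_zero, zero_mul]
    exact mul_nonneg (mul_nonneg (by positivity) (add_nonneg hG (by positivity))) (norm_nonneg y)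
  obtain ⟨n, rfl⟩ := Nat.exists_eq_add_of_le hk
  have htail := H.abs_tailInv_le_greenSum (t := P.s - P.sL) (by linarith [H.s_pos]) (norm_nonneg y)
    (y := infPart P.m y) (fun _ => y.abs_le _) n
  have hgreen := greenSum_one_div_wt_le hθ.le H.θ_lt_one H.s_pos.le P.m_pos.ne' n
  have hgeom := geomWeight_le_tsum hθ H.θ_lt_one H.s_pos.le P.m_pos n
  rw [sub_add_cancel] at htail
  have hwt := wt_pos P.s (P.m + n)
  rw [tailSeq_add_left, ← le_div_iff₀ hwt]
  calc |P.tailInv (infPart P.m y) n|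
      ≤ P.η * (‖y‖ / P.C₁ * (1 / wt P.s (P.m + n) * (geomWeight P.θ P.s P.m n
          + P.θ / (1 - P.θ)))) := htail.trans (by gcongr)
    _ ≤ P.η * (‖y‖ / P.C₁ * (1 / wt P.s (P.m + n) * (G + P.θ / (1 - P.θ)))) := by gcongr
    _ = P.η / P.C₁ * (G + P.θ / (1 - P.θ)) * ‖y‖ / wt P.s (P.m + n) := by ring

/-- The map `y ↦ (0, …, 0, 𝓣⁻¹ y_I)` as a bounded map `Ω^{s - s_L} → Ω^s`. -/
def tailCLM : Omega (P.s - P.sL) →L[ℝ] Omega P.s :=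
  Omega.mkCLM
    { toFun := fun y => P.tailSeq y
      map_add' := fun y z => funext fun k => by
        have hsplit : infPart P.m (y + z : Omega (P.s - P.sL)) = infPart P.m y + infPart P.m z :=
          rfl
        simp only [tailSeq, Pi.add_apply, hsplit,
          H.tailInv_add (H.abs_infPart_div_b_le y) (H.abs_infPart_div_b_le z)]
        split_ifs <;> simp
      map_smul' := fun c y => funext fun k => by
        have hsmul : infPart P.m (c • y : Omega (P.s - P.sL)) = c • infPart P.m y := rfl
        simp only [tailSeq, Pi.smul_apply, hsmul, tailInv_smul, RingHom.id_apply]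
        split_ifs <;> simp }
    _ H.abs_tailSeq_mul_wt_le

theorem tailCLM_apply (y : Omega (P.s - P.sL)) (k : ℕ) : H.tailCLM y k = P.tailSeq y k := rfl

/-- The sequence `(0, …, 0, w)` as a point of `Ω^s`. -/
def wSeq : Omega P.s := H.tailCLM P.unitTail

theorem wSeq_of_lt {k : ℕ} (hk : k < P.m) : H.wSeq k = 0 := tailSeq_of_lt _ hk

theorem wSeq_add_left (k : ℕ) : H.wSeq (P.m + k) = P.wI k := by
  rw [wSeq, tailCLM_apply, tailSeq_add_left, infPart_unitTail, wI]

/-- The functional `y ↦ (𝓣⁻¹ y_I)_0`. -/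
def headCLM : Omega (P.s - P.sL) →L[ℝ] ℝ := (Omega.eval P.s P.m).comp H.tailCLM

theorem headCLM_apply (y : Omega (P.s - P.sL)) :
    H.headCLM y = P.tailInv (infPart P.m y) 0 := P.tailSeq_add_left y 0

/-- The operator `A` as a bounded map `Ω^{s - s_L} → Ω^s`. -/
def ACLM : Omega (P.s - P.sL) →L[ℝ] Omega P.s :=
  (extendCLM P.s P.m).comp (amCLM P)
    - P.beta (P.m - 1) • H.headCLM.smulRight (extendCLM P.s P.m fun i => P.Am i P.last)
    - P.lam P.m • ((ContinuousLinearMap.proj P.last).comp (amCLM P)).smulRight H.wSeq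
    + H.tailCLM
    + (P.beta (P.m - 1) * P.lam P.m * P.Am P.last P.last) • H.headCLM.smulRight H.wSeq

theorem ACLM_apply (y : Omega (P.s - P.sL)) (k : ℕ) : H.ACLM y k = P.A y k := by
  have hdef : H.ACLM y k = extend (P.Am.mulVec (finPart P.m y)) k
      - P.beta (P.m - 1) * (H.headCLM y * extend (fun i => P.Am i P.last) k)
      - P.lam P.m * (P.Am.mulVec (finPart P.m y) P.last * H.wSeq k)
      + P.tailSeq y k
      + P.beta (P.m - 1) * P.lam P.m * P.Am P.last P.last * (H.headCLM y * H.wSeq k) := rfl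
  rw [hdef, headCLM_apply, A]
  split_ifs with hk
  · rw [extend_of_lt _ hk, extend_of_lt _ hk, H.wSeq_of_lt hk, tailSeq_of_lt _ hk]
    ring
  · obtain ⟨n, rfl⟩ := Nat.exists_eq_add_of_le (not_lt.1 hk)
    rw [extend_of_le _ (Nat.le_add_right _ _), extend_of_le _ (Nat.le_add_right _ _),
      H.wSeq_add_left, tailSeq_add_left, Nat.add_sub_cancel_left]
    ring

/-! ### The Newton-like operator -/

/-- `f` as a map `Ω^s → Ω^{s - s_L}`. The constant `g` enters through its first `2m` entries, the
only ones that the theorem allows to be non-zero. -/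
def fMap (x : Omega P.s) : Omega (P.s - P.sL) :=
  H.linCLM x + Omega.inclusion (sub_le_self _ H.sL_nonneg)
    (P.σ • convCLM H.one_lt_s x x + extendCLM _ (2 * P.m) fun i => P.g i)

theorem fMap_apply (hg : ∀ k, 2 * P.m - 1 ≤ k → P.g k = 0) (x : Omega P.s) (k : ℕ) :
    H.fMap x k = P.f x k := by
  have hext : extend (fun i : Fin (2 * P.m) => P.g i) k = P.g k := by
    rcases lt_or_ge k (2 * P.m) with hk | hk
    · rw [extend_of_lt _ hk]
    · rw [extend_of_le _ hk, hg k (by omega)]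
  change P.lin x k + (P.σ * conv x x k + extend (fun i : Fin (2 * P.m) => P.g i) k) = _
  rw [hext]
  rfl

/-- The derivative `h ↦ 𝓛 h + 2σ (x * h)` of `f`. -/
def fDeriv (x : Omega P.s) : Omega P.s →L[ℝ] Omega (P.s - P.sL) :=
  H.linCLM + (Omega.inclusion (sub_le_self _ H.sL_nonneg)).comp
    ((2 * P.σ) • convCLM H.one_lt_s x)

theorem fDeriv_apply (x h : Omega P.s) (k : ℕ) :
    H.fDeriv x h k = P.lin h k + 2 * P.σ * conv x h k := rfl

theorem hasFDerivAt_fMap (x : Omega P.s) : HasFDerivAt H.fMap (H.fDeriv x) x := by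
  have hconv := (convCLM H.one_lt_s).hasFDerivAt_of_bilinear (hasFDerivAt_id x) (hasFDerivAt_id x)
  have hnonlin := (Omega.inclusion (sub_le_self P.s H.sL_nonneg)).hasFDerivAt.comp x
    ((hconv.const_smul P.σ).add_const (extendCLM P.s (2 * P.m) fun i => P.g i))
  refine (H.linCLM.hasFDerivAt.add hnonlin).congr_fderiv ?_
  ext y
  refine Omega.ext fun k => ?_
  change P.lin y k + P.σ * (conv x y k + conv y x k) = P.lin y k + 2 * P.σ * conv x y k
  rw [conv_comm y x]
  ring

/-- The Newton-like operator `T = id - A f`. -/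
def newton (x : Omega P.s) : Omega P.s := x - H.ACLM (H.fMap x)

theorem newton_apply (hg : ∀ k, 2 * P.m - 1 ≤ k → P.g k = 0) (x : Omega P.s) (k : ℕ) :
    H.newton x k = x k - P.A (P.f x) k := by
  have hf : (H.fMap x : ℕ → ℝ) = P.f x := funext (H.fMap_apply hg x)
  rw [newton, Omega.sub_apply, ACLM_apply, hf]

theorem hasFDerivAt_newton (x : Omega P.s) :
    HasFDerivAt H.newton (ContinuousLinearMap.id ℝ _ - H.ACLM.comp (H.fDeriv x)) x :=
  (hasFDerivAt_id x).sub (H.ACLM.hasFDerivAt.comp x (H.hasFDerivAt_fMap x))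

theorem D_mulVec (hg : ∀ k, 2 * P.m - 1 ≤ k → P.g k = 0) (v : Fin P.m → ℝ) (i : Fin P.m) :
    P.D.mulVec v i = P.lin (extend v) i + 2 * P.σ * conv P.xbar (extend v) i := by
  have hfProj : P.fProj = fun u => Omega.finCLM _ P.m (H.fMap (extendCLM P.s P.m u)) :=
    funext fun u => funext fun i => (H.fMap_apply hg (extendCLM P.s P.m u) i).symm
  have hderiv : HasFDerivAt P.fProj ((Omega.finCLM _ P.m).comp
      ((H.fDeriv (extendCLM P.s P.m P.xF)).comp (extendCLM P.s P.m))) P.xF := by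
    rw [hfProj]
    exact (Omega.finCLM _ P.m).hasFDerivAt.comp P.xF
      ((H.hasFDerivAt_fMap _).comp P.xF (extendCLM P.s P.m).hasFDerivAt)
  rw [D, hderiv.fderiv, LinearMap.toMatrix'_mulVec]
  rfl

end Regular

end Data

/-! ### The bound `Y` -/

theorem greenSum_of_support {θ : ℝ} {q : ℕ → ℝ} {N : ℕ} (hq : ∀ j, N < j → q j = 0) (k : ℕ) :
    greenSum θ q k = ∑ j ∈ Finset.range k, θ ^ (k - j) * q j
      + ∑ l ∈ Finset.Ico k (N + 1), θ ^ (l - k) * q l := by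
  unfold greenSum
  rw [Finset.sum_Ico_eq_sum_range, tsum_eq_sum (s := Finset.range (N + 1 - k))]
  · simp only [Nat.add_sub_cancel_left]
  · intro i hi
    rw [Finset.mem_range] at hi
    rw [hq _ (by omega), mul_zero]

theorem greenSum_of_support_le {θ : ℝ} {q : ℕ → ℝ} {N : ℕ} (hq : ∀ j, N < j → q j = 0) {k : ℕ}
    (hk : k ≤ N) :
    greenSum θ q k = ∑ j ∈ Finset.Icc 0 k, θ ^ (k - j) * q j
      + ∑ l ∈ Finset.Icc (k + 1) N, θ ^ (l - k) * q l := by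
  rw [greenSum_of_support hq, Finset.sum_eq_sum_Ico_succ_bot (show k < N + 1 by omega), ← add_assoc,
    ← Nat.range_succ_eq_Icc_zero, Finset.sum_range_succ, Finset.Ico_add_one_right_eq_Icc]

theorem greenSum_of_le_support {θ : ℝ} (hθ : θ ≠ 0) {q : ℕ → ℝ} {N : ℕ}
    (hq : ∀ j, N < j → q j = 0) {k : ℕ} (hk : N ≤ k) :
    greenSum θ q k = θ ^ k * ∑ l ∈ Finset.Icc 0 N, q l / θ ^ l := by
  rw [greenSum_of_support_le (fun j hj => hq j (hk.trans_lt hj)) le_rfl,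
    Finset.Icc_eq_empty (Nat.not_succ_le_self k), Finset.sum_empty, add_zero, Finset.mul_sum,
    ← Finset.sum_subset (Finset.Icc_subset_Icc_right hk) fun j _ hjN => by
      rw [hq j (by simpa using hjN), mul_zero]]
  refine Finset.sum_congr rfl fun j hj => ?_
  rw [pow_sub₀ _ hθ ((Finset.mem_Icc.1 hj).2.trans hk)]
  ring

namespace Data

theorem glue_le_of_le (P : Data) {x : ℕ → ℝ} {u : Fin P.m → ℝ} {v : ℕ → ℝ}
    (hfin : ∀ i : Fin P.m, x i ≤ u i) (hmid : ∀ n, n ≤ P.M → x (P.m + n) ≤ v n)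
    (htail : ∀ n, P.M < n → x (P.m + n) ≤ v P.M * wt P.s (P.m + P.M) / wt P.s (P.m + n))
    (k : ℕ) : x k ≤ P.glue u v k := by
  unfold glue
  split_ifs with hk hkM
  · exact hfin ⟨k, hk⟩
  all_goals obtain ⟨n, rfl⟩ := Nat.exists_eq_add_of_le (not_lt.1 hk)
  · rw [Nat.add_sub_cancel_left]
    exact hmid n (by omega)
  · exact htail n (by omega)

theorem xbar_of_le (P : Data) {k : ℕ} (hk : P.m ≤ k) : P.xbar k = 0 := extend_of_le _ hk

section

variable {P : Data} (hg : ∀ k, 2 * P.m - 1 ≤ k → P.g k = 0) (hm : 2 ≤ P.m)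
include hg hm

theorem f_xbar_eq_zero {k : ℕ} (hk : 2 * P.m - 1 ≤ k) : P.f P.xbar k = 0 := by
  have hconv : conv P.xbar P.xbar k = 0 := by
    refine (tsum_congr fun j => ?_).trans tsum_zero
    rcases lt_or_ge j.natAbs P.m with hj | hj
    · rw [P.xbar_of_le (k := ((k : ℤ) - j).natAbs) (by omega), mul_zero]
    · rw [P.xbar_of_le hj, zero_mul]
  rw [f, nonlin, hconv, hg k hk, lin_eq, P.xbar_of_le (k := k - 1) (by omega),
    P.xbar_of_le (k := k) (by omega), P.xbar_of_le (k := k + 1) (by omega)]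
  simp

theorem q_eq_zero {l : ℕ} (hl : P.m - 2 < l) : P.q l = 0 := by
  rw [q, f_xbar_eq_zero hg hm (by omega), abs_zero, zero_div]

theorem greenSum_q_zero : greenSum P.θ P.q 0 = P.S := by
  rw [greenSum_of_support fun j => q_eq_zero hg hm, Finset.range_zero, Finset.sum_empty, zero_add,
    Finset.Ico_add_one_right_eq_Icc]
  rfl

end

theorem YI_of_le (P : Data) {n : ℕ} (hn : P.m ≤ n + 2) :
    P.YI n = ((|P.Am.mulVec (finPart P.m (P.f P.xbar)) P.last|
      + |P.beta (P.m - 1) * P.Am P.last P.last| * P.η * P.S) * P.η * (|P.lam P.m| / |P.mu P.m|)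
      + P.η * ∑ l ∈ Finset.Icc 0 (P.m - 2), P.q l / P.θ ^ l) * P.θ ^ n := by
  rw [YI, if_neg (by omega)]
  ring

theorem abs_A_fin_le (P : Data) (y : ℕ → ℝ) (i : Fin P.m) :
    |P.A y i| ≤ |P.Am.mulVec (finPart P.m y) i|
      + |P.beta (P.m - 1)| * |P.tailInv (infPart P.m y) 0| * |P.Am i P.last| := by
  rw [A, dif_pos i.2, ← abs_mul, ← abs_mul]
  exact abs_sub _ _

theorem A_tail (P : Data) (y : ℕ → ℝ) (n : ℕ) :
    P.A y (P.m + n)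
      = (P.beta (P.m - 1) * P.Am P.last P.last * P.tailInv (infPart P.m y) 0
          - P.Am.mulVec (finPart P.m y) P.last) * (P.lam P.m * P.wI n)
        + P.tailInv (infPart P.m y) n := by
  rw [A, dif_neg (by omega), Nat.add_sub_cancel_left]
  ring

namespace TailDominant

variable {P : Data} (H : P.TailDominant)
include H

theorem abs_lam_mul_wI_le (n : ℕ) :
    |P.lam P.m * P.wI n| ≤ P.η * P.θ ^ n * (|P.lam P.m| / |P.mu P.m|) := by
  rw [abs_mul]
  refine (mul_le_mul_of_nonneg_left (H.abs_wI_le n) (abs_nonneg _)).trans_eq ?_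
  ring

theorem abs_A_tail_le (y : ℕ → ℝ) (n : ℕ) :
    |P.A y (P.m + n)| ≤ (|P.Am.mulVec (finPart P.m y) P.last|
        + |P.beta (P.m - 1) * P.Am P.last P.last| * |P.tailInv (infPart P.m y) 0|)
          * (P.η * P.θ ^ n * (|P.lam P.m| / |P.mu P.m|))
      + |P.tailInv (infPart P.m y) n| := by
  rw [A_tail, add_comm |P.Am.mulVec _ _|, ← abs_mul (P.beta (P.m - 1) * P.Am P.last P.last)]
  refine (abs_add_le _ _).trans (add_le_add_left ?_ _)
  rw [abs_mul]
  gcongr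
  · exact abs_sub _ _
  · exact H.abs_lam_mul_wI_le n

variable (hg : ∀ k, 2 * P.m - 1 ≤ k → P.g k = 0) (hm : 2 ≤ P.m)
include hg hm

theorem abs_tailInv_f_xbar_le (k : ℕ) :
    |P.tailInv (infPart P.m (P.f P.xbar)) k| ≤ P.η * greenSum P.θ P.q k := by
  have hq : (fun j => |infPart P.m (P.f P.xbar) j / P.b (j + 1)|) = P.q :=
    funext fun j => abs_div _ _
  have hbound : ∀ j, P.q j ≤ ∑ l ∈ Finset.range (P.m - 1), P.q l := fun j => by
    have hnonneg : ∀ l, 0 ≤ P.q l := fun l => div_nonneg (abs_nonneg _) (abs_nonneg _)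
    rcases lt_or_ge j (P.m - 1) with hj | hj
    · exact Finset.single_le_sum (fun l _ => hnonneg l) (Finset.mem_range.2 hj)
    · rw [q_eq_zero hg hm (by omega)]
      exact Finset.sum_nonneg fun l _ => hnonneg l
  have h := H.abs_tailInv_le (fun j => (congrFun hq j).trans_le (hbound j)) k
  rwa [hq] at h

theorem abs_tailInv_f_xbar_zero_le :
    |P.tailInv (infPart P.m (P.f P.xbar)) 0| ≤ P.η * P.S :=
  (H.abs_tailInv_f_xbar_le hg hm 0).trans_eq (by rw [greenSum_q_zero hg hm])

theorem abs_A_f_xbar_fin_le (i : Fin P.m) : |P.A (P.f P.xbar) i| ≤ P.YF i := by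
  refine (P.abs_A_fin_le _ i).trans (add_le_add_right ?_ _)
  rw [mul_assoc |P.beta _| P.η]
  gcongr
  exact H.abs_tailInv_f_xbar_zero_le hg hm

theorem abs_A_f_xbar_tail_le (n : ℕ) : |P.A (P.f P.xbar) (P.m + n)| ≤ P.YI n := by
  have hη := H.η_pos
  have hθ := H.θ_pos
  have hgreen : P.η * greenSum P.θ P.q n = if n + 3 ≤ P.m then
      P.η * ∑ l ∈ Finset.Icc 0 n, P.θ ^ (n - l) * P.q l
        + P.η * ∑ l ∈ Finset.Icc (n + 1) (P.m - 2), P.θ ^ (l - n) * P.q l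
    else
      P.η * P.θ ^ n * ∑ l ∈ Finset.Icc 0 (P.m - 2), P.q l / P.θ ^ l := by
    split_ifs with hn
    · rw [greenSum_of_support_le (fun j => q_eq_zero hg hm) (by omega), mul_add]
    · rw [greenSum_of_le_support hθ.ne' (fun j => q_eq_zero hg hm) (by omega), mul_assoc]
  refine (H.abs_A_tail_le _ n).trans
    (add_le_add ?_ ((H.abs_tailInv_f_xbar_le hg hm n).trans_eq hgreen))
  rw [mul_assoc _ P.η P.S, mul_assoc _ P.η (P.θ ^ n), mul_assoc _ (P.η * P.θ ^ n)]
  gcongr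
  exact H.abs_tailInv_f_xbar_zero_le hg hm

theorem abs_A_f_xbar_le (hs : 0 ≤ P.s) (hMA : P.CondMA) (hMY : P.CondMY) (k : ℕ) :
    |P.A (P.f P.xbar) k| ≤ P.Y k := by
  refine P.glue_le_of_le (x := fun k => |P.A (P.f P.xbar) k|) (H.abs_A_f_xbar_fin_le hg hm)
    (fun n _ => H.abs_A_f_xbar_tail_le hg hm n) (fun n hn => ?_) k
  have hmM := hMA.m_le_M
  have hYI := H.abs_A_f_xbar_tail_le hg hm n
  have hYI_nonneg := (abs_nonneg _).trans hYI
  refine hYI.trans ?_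
  rw [P.YI_of_le (by omega)] at hYI_nonneg ⊢
  rw [P.YI_of_le (by omega), mul_assoc _ (P.θ ^ P.M), mul_div_assoc]
  exact mul_le_mul_of_nonneg_left
    (pow_le_pow_mul_wt_div_wt H.θ_pos hs P.m_pos.ne' (H.s_le hMY) hn.le)
    (nonneg_of_mul_nonneg_left hYI_nonneg (pow_pos H.θ_pos n))

end TailDominant

end Data

/-! ### The defect `I - A A†` -/

theorem abs_mulVec_le {ι κ : Type*} [Fintype κ] (B : Matrix ι κ ℝ) {u v : κ → ℝ}
    (h : ∀ j, |u j| ≤ v j) (i : ι) : |B.mulVec u i| ≤ (B.map abs).mulVec v i := by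
  refine (Finset.abs_sum_le_sum_abs (fun j => B i j * u j) Finset.univ).trans
    (Finset.sum_le_sum fun j _ => ?_)
  rw [abs_mul]
  exact mul_le_mul_of_nonneg_left (h j) (abs_nonneg _)

namespace Data

variable {P : Data} {C₂ : ℝ}

theorem KTilde_mulVec (P : Data) (v : Fin P.m → ℝ) :
    P.KTilde.mulVec v = P.D.mulVec v
      - Pi.single P.last (P.beta (P.m - 1) * P.lam P.m * P.wTilde * v P.last) := by
  rw [KTilde, Matrix.sub_mulVec, Matrix.smul_mulVec, Matrix.single_mulVec]
  congr 1
  funext i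
  rcases eq_or_ne i P.last with rfl | hi
  · simp [mul_assoc]
  · simp [hi]

theorem Am_mulVec_single_last (P : Data) (c : ℝ) (i : Fin P.m) :
    P.Am.mulVec (Pi.single P.last c) i = c * P.Am i P.last := by
  simp [Matrix.mulVec_single, mul_comm]

/-- The finite part of `(I - A A†) h`, see `Regular.sub_A_dagger_fin`. -/
def defect (P : Data) (h : ℕ → ℝ) (i : Fin P.m) : ℝ :=
  (1 - P.Am * P.KTilde).mulVec (finPart P.m h) i
    + P.beta (P.m - 1) * P.lam P.m * h (P.m - 1) * (P.wI 0 - P.wTilde) * P.Am i P.last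

theorem defect_eq (P : Data) (h : ℕ → ℝ) (i : Fin P.m) :
    P.defect h i = h i - P.Am.mulVec (P.D.mulVec (finPart P.m h)) i
      + P.beta (P.m - 1) * P.lam P.m * h (P.m - 1) * P.wI 0 * P.Am i P.last := by
  rw [defect, Matrix.sub_mulVec, Matrix.one_mulVec, ← Matrix.mulVec_mulVec, KTilde_mulVec,
    Matrix.mulVec_sub, Pi.sub_apply, Pi.sub_apply, Am_mulVec_single_last,
    show finPart P.m h P.last = h (P.m - 1) from rfl, show finPart P.m h i = h i from rfl]
  ring

namespace Regular

variable (H : P.Regular C₂)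
include H

/-- `A† h`, where `A†` acts as `D` on the finite part and as the tridiagonal operator `𝓛` on the
tail, including the entries of `𝓛` that couple the two. -/
def dagger (h : Omega P.s) : Omega (P.s - P.sL) :=
  H.linCLM h + (2 * P.σ) • extendCLM _ P.m (Omega.finCLM _ P.m
    (convCLM H.one_lt_s P.xbarOmega (extendCLM _ P.m (Omega.finCLM _ P.m h))))

theorem dagger_apply (h : Omega P.s) (k : ℕ) :
    H.dagger h k = P.lin h k
      + 2 * P.σ * extend (finPart P.m (conv P.xbar (extend (finPart P.m h)))) k := rfl

theorem finPart_dagger (hg : ∀ k, 2 * P.m - 1 ≤ k → P.g k = 0) (h : Omega P.s) :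
    finPart P.m (H.dagger h) = P.D.mulVec (finPart P.m h)
      + Pi.single P.last (P.beta (P.m - 1) * h P.m) := by
  funext i
  have hext : ∀ k, k < P.m → extend (finPart P.m h) k = h k := fun k hk => extend_of_lt _ hk
  rw [Pi.add_apply, H.D_mulVec hg, finPart, H.dagger_apply, lin_eq, lin_eq,
    extend_of_lt _ i.2, hext (i - 1) (by omega), hext i i.2]
  simp only [finPart]
  rcases eq_or_ne i P.last with hi | hi
  · have hlast : (i : ℕ) = P.m - 1 := congrArg Fin.val hi
    rw [hi, Pi.single_eq_same, ← hi, hlast, Nat.sub_add_cancel P.m_pos, extend_of_le _ le_rfl]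
    ring
  · have hlast : (i : ℕ) ≠ P.m - 1 := fun hc => hi (Fin.ext hc)
    rw [Pi.single_eq_of_ne hi, hext (i + 1) (by omega)]
    ring

theorem tri_infPart (h : Omega P.s) :
    P.tri (infPart P.m h) = infPart P.m (H.dagger h)
      + (-(P.lam P.m * h (P.m - 1))) • Pi.single 0 1 := by
  funext n
  have hm := P.m_pos
  rw [Pi.add_apply, infPart, H.dagger_apply, extend_of_le _ (Nat.le_add_right _ _), lin_eq,
    if_neg (by omega)]
  rcases n with _ | n
  · simp [tri, infPart, b, c]
    ring
  · rw [show P.m + (n + 1) - 1 = P.m + n by omega]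
    simp [tri, infPart, a, b, c, add_assoc]

theorem tailInv_dagger (h : Omega P.s) (n : ℕ) :
    P.tailInv (infPart P.m (H.dagger h)) n
      = P.lam P.m * h (P.m - 1) * P.wI n + h (P.m + n) := by
  have hx : ∀ j, |infPart P.m h j| ≤ ‖h‖ := fun j => (h.abs_le _).trans
    (div_le_self (norm_nonneg _) (one_le_wt H.s_pos.le _))
  have hb : ∀ j, |((-(P.lam P.m * h (P.m - 1))) • Pi.single 0 1 : ℕ → ℝ) j / P.b (j + 1)|
      ≤ |-(P.lam P.m * h (P.m - 1))| * (1 / |P.mu P.m|) := fun j => by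
    rw [Pi.smul_apply, smul_eq_mul, mul_div_assoc, abs_mul]
    exact mul_le_mul_of_nonneg_left (abs_single_div_b_le P j) (abs_nonneg _)
  have hinv := congrFun (H.tailInv_tri hx) n
  rw [H.tri_infPart, H.tailInv_add (H.abs_infPart_div_b_le _) hb, tailInv_smul, Pi.add_apply,
    Pi.smul_apply, smul_eq_mul] at hinv
  change _ + _ * P.wI n = h (P.m + n) at hinv
  linarith

theorem sub_A_dagger_fin (hg : ∀ k, 2 * P.m - 1 ≤ k → P.g k = 0) (h : Omega P.s) (i : Fin P.m) :
    h i - P.A (H.dagger h) i = P.defect h i := by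
  rw [A, dif_pos i.2, H.finPart_dagger hg, H.tailInv_dagger, Matrix.mulVec_add,
    Pi.add_apply, Am_mulVec_single_last, defect_eq, add_zero]
  ring

theorem sub_A_dagger_tail (hg : ∀ k, 2 * P.m - 1 ≤ k → P.g k = 0) (h : Omega P.s) (n : ℕ) :
    h (P.m + n) - P.A (H.dagger h) (P.m + n) = -(P.lam P.m * P.wI n * P.defect h P.last) := by
  rw [A_tail, H.finPart_dagger hg, H.tailInv_dagger, H.tailInv_dagger, Matrix.mulVec_add,
    Pi.add_apply, Am_mulVec_single_last, defect_eq, add_zero,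
    show h (P.last : ℕ) = h (P.m - 1) from rfl]
  ring

end Regular

theorem abs_apply_le_of_norm_le {s r : ℝ} {h : Omega s} (hr : ‖h‖ ≤ r) (k : ℕ) :
    |h k| ≤ r / wt s k :=
  (h.abs_le k).trans (div_le_div_of_nonneg_right hr (wt_pos s k).le)

theorem TailDominant.abs_defect_le (H : P.TailDominant) (hL : 1 ≤ P.L) {r : ℝ} {h : Omega P.s}
    (hr : ‖h‖ ≤ r) (i : Fin P.m) :
    |P.defect h i| ≤ (P.absDefect.mulVec P.WF i + P.ε * P.absAm i P.last) * r := by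
  have hfin : |(1 - P.Am * P.KTilde).mulVec (finPart P.m h) i|
      ≤ P.absDefect.mulVec P.WF i * r := by
    refine (abs_mulVec_le _ (v := r • P.WF) (fun j => ?_) i).trans_eq ?_
    · exact (abs_apply_le_of_norm_le hr j).trans_eq (mul_one_div r _).symm
    · rw [Matrix.mulVec_smul, Pi.smul_apply, smul_eq_mul, mul_comm]
      rfl
  have hcoupling :
      |P.beta (P.m - 1) * P.lam P.m * h (P.m - 1) * (P.wI 0 - P.wTilde) * P.Am i P.last|
        ≤ P.ε * P.absAm i P.last * r := by
    have hwt := wt_pos P.s (P.m - 1)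
    have hr0 := (norm_nonneg h).trans hr
    simp only [abs_mul]
    calc |P.beta (P.m - 1)| * |P.lam P.m| * |h (P.m - 1)| * |P.wI 0 - P.wTilde| * |P.Am i P.last|
        ≤ |P.beta (P.m - 1)| * |P.lam P.m| * (r / wt P.s (P.m - 1))
          * (P.θ ^ (2 * P.L) / (|P.mu P.m| * (1 - P.θ ^ 2))) * |P.Am i P.last| := by
          gcongr
          · exact abs_apply_le_of_norm_le hr _
          · exact H.abs_wI_sub_wTilde_le hL
      _ = P.ε * P.absAm i P.last * r := by
          rw [show P.absAm i P.last = |P.Am i P.last| from rfl, ε]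
          generalize 1 - P.θ ^ 2 = d
          ring
  rw [add_mul]
  exact (abs_add_le _ _).trans (add_le_add hfin hcoupling)

/-! ### The remainder `Df(x̄ + b₁) h - A† h` -/

theorem convWeight_add_zetaUp_nonneg {s : ℝ} (hs : 1 < s) {L : ℕ} (hL : 1 ≤ L) (k : ℕ) :
    0 ≤ convWeight s k + zetaUp s L :=
  (tsum_nonneg fun _ => convTerm_nonneg _ _ _).trans (tsum_convTerm_le hs hL k)

theorem abs_conv_le_of_norm_le {s : ℝ} (hs : 1 < s) {L : ℕ} (hL : 1 ≤ L) {x y : Omega s}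
    {α u v : ℝ} {k : ℕ} (hα : convWeight s k + zetaUp s L ≤ α) (hx : ‖x‖ ≤ u) (hy : ‖y‖ ≤ v) :
    |conv x y k| ≤ α * (u * v) / wt s k := by
  have hα0 := (convWeight_add_zetaUp_nonneg hs hL k).trans hα
  have hu := (norm_nonneg x).trans hx
  have hwt := wt_pos s k
  refine (abs_conv_le hs hL x y k).trans ?_
  rw [mul_assoc]
  gcongr

theorem αm_nonneg (hs : 1 < P.s) (hL : 1 ≤ P.L) (hm : 6 ≤ P.m) : 0 ≤ P.αm :=
  (convWeight_add_zetaUp_nonneg hs hL P.m).trans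
    (convWeight_add_zetaUp_le_alpha hs hL hm le_rfl)

theorem conv_xbar_of_vanish (P : Data) {d : ℕ → ℝ} (hd : ∀ k, k < P.m → d k = 0) {k : ℕ}
    (hk : k < P.m) :
    conv P.xbar d k = ∑ l ∈ Finset.Icc (P.m - k) (P.m - 1), P.xbar l * d (k + l) := by
  unfold conv
  rw [tsum_eq_sum (s := (Finset.Icc (P.m - k) (P.m - 1)).image fun l : ℕ => -(l : ℤ)),
    Finset.sum_image (fun a _ b _ hab => by simpa using hab)]
  · refine Finset.sum_congr rfl fun l _ => ?_
    rw [show (-(l : ℤ)).natAbs = l by omega, show ((k : ℤ) - -(l : ℤ)).natAbs = k + l by omega]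
  · intro j hj
    rcases lt_or_ge j.natAbs P.m with hxbar | hxbar
    · rcases lt_or_ge ((k : ℤ) - j).natAbs P.m with hdj | hdj
      · rw [hd _ hdj, mul_zero]
      · exact absurd (Finset.mem_image.2 ⟨j.natAbs, Finset.mem_Icc.2 ⟨by omega, by omega⟩,
          by omega⟩) hj
    · rw [P.xbar_of_le hxbar, zero_mul]

theorem abs_conv_xbar_sub_le {r : ℝ} {h : Omega P.s} (hr : ‖h‖ ≤ r) (i : Fin P.m) :
    |conv P.xbar (h - extendCLM P.s P.m (finPart P.m h) : Omega P.s) i|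
      ≤ (∑ l ∈ Finset.Icc (P.m - i) (P.m - 1), |P.xbar l| / wt P.s (i + l)) * r := by
  have hd : ∀ k, (h - extendCLM P.s P.m (finPart P.m h) : Omega P.s) k
      = h k - extend (finPart P.m h) k := fun _ => rfl
  rw [P.conv_xbar_of_vanish (fun k hk => by rw [hd, extend_of_lt _ hk, finPart, sub_self]) i.2,
    Finset.sum_mul]
  refine (Finset.abs_sum_le_sum_abs _ _).trans (Finset.sum_le_sum fun l hl => ?_)
  rw [Finset.mem_Icc] at hl
  rw [hd, extend_of_le _ (by omega), sub_zero, abs_mul, div_mul_eq_mul_div, mul_div_assoc]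
  exact mul_le_mul_of_nonneg_left (abs_apply_le_of_norm_le hr _) (abs_nonneg _)

/-- The factor of `1 / ω_k^s` in the bound of the tail of the remainder. -/
def tailConst (P : Data) (r : ℝ) : ℝ :=
  2 * |P.σ| * P.αm * (seqNorm P.s P.xbar * r + r ^ 2)

theorem tailConst_nonneg (hs : 1 < P.s) (hL : 1 ≤ P.L) (hm : 6 ≤ P.m) {r : ℝ} (hr : 0 ≤ r) :
    0 ≤ P.tailConst r := by
  have hα := P.αm_nonneg hs hL hm
  have hxbar : 0 ≤ seqNorm P.s P.xbar := norm_nonneg P.xbarOmega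
  unfold tailConst
  positivity

namespace Regular

variable (H : P.Regular C₂)
include H

/-- `Df(x̄ + b₁) h - A† h`. -/
def remainder (b₁ h : Omega P.s) : Omega (P.s - P.sL) :=
  H.fDeriv (P.xbarOmega + b₁) h - H.dagger h

theorem remainder_apply (b₁ h : Omega P.s) (k : ℕ) :
    H.remainder b₁ h k = 2 * P.σ * (conv P.xbarOmega h k + conv b₁ h k
      - extend (finPart P.m (conv P.xbar (extend (finPart P.m h)))) k) := by
  rw [remainder, Omega.sub_apply, fDeriv_apply, dagger_apply, conv_add_left H.one_lt_s]
  ring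

theorem remainder_fin (b₁ h : Omega P.s) (i : Fin P.m) :
    H.remainder b₁ h i = 2 * P.σ *
      (conv P.xbar (h - extendCLM P.s P.m (finPart P.m h) : Omega P.s) i + conv b₁ h i) := by
  have hsplit := conv_add_right H.one_lt_s P.xbarOmega (h - extendCLM P.s P.m (finPart P.m h))
    (extendCLM P.s P.m (finPart P.m h)) i
  rw [sub_add_cancel] at hsplit
  rw [remainder_apply, hsplit, extend_of_lt _ i.2]
  change 2 * P.σ * (conv P.xbar _ i + conv P.xbar (extend (finPart P.m h)) i + _
    - conv P.xbar (extend (finPart P.m h)) i) = _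
  ring

theorem abs_remainder_fin_le (hL : 1 ≤ P.L) {r : ℝ} {b₁ h : Omega P.s} (hb : ‖b₁‖ ≤ r)
    (hr : ‖h‖ ≤ r) (i : Fin P.m) :
    |H.remainder b₁ h i| ≤ P.C1F i * r + P.C2F i * r ^ 2 := by
  rw [remainder_fin, abs_mul, abs_mul, abs_two, C1F, C2F]
  calc _ ≤ 2 * |P.σ| * ((∑ l ∈ Finset.Icc (P.m - i) (P.m - 1), |P.xbar l| / wt P.s (i + l)) * r
        + alpha P.s P.L P.m i * (r * r) / wt P.s i) :=
        mul_le_mul_of_nonneg_left ((abs_add_le _ _).trans (add_le_add (abs_conv_xbar_sub_le hr i)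
          (abs_conv_le_of_norm_le H.one_lt_s hL (convWeight_add_zetaUp_eq_alpha _ _ i.2).le hb hr)))
          (by positivity)
    _ = _ := by ring

theorem abs_remainder_tail_le (hL : 1 ≤ P.L) (hm : 6 ≤ P.m) {r : ℝ} {b₁ h : Omega P.s}
    (hb : ‖b₁‖ ≤ r) (hr : ‖h‖ ≤ r) (n : ℕ) :
    |infPart P.m (H.remainder b₁ h) n| ≤ P.tailConst r / wt P.s (P.m + n) := by
  have hα := convWeight_add_zetaUp_le_alpha H.one_lt_s hL hm (Nat.le_add_right P.m n)
  rw [infPart, remainder_apply, extend_of_le _ (Nat.le_add_right _ _), sub_zero, abs_mul, abs_mul,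
    abs_two]
  calc _ ≤ 2 * |P.σ| * (P.αm * (seqNorm P.s P.xbar * r) / wt P.s (P.m + n)
        + P.αm * (r * r) / wt P.s (P.m + n)) :=
        mul_le_mul_of_nonneg_left ((abs_add_le _ _).trans
          (add_le_add (abs_conv_le_of_norm_le H.one_lt_s hL hα le_rfl hr)
            (abs_conv_le_of_norm_le H.one_lt_s hL hα hb hr))) (by positivity)
    _ = P.tailConst r / wt P.s (P.m + n) := by rw [tailConst]; ring

theorem abs_mulVec_remainder_le (hL : 1 ≤ P.L) {r : ℝ} {b₁ h : Omega P.s} (hb : ‖b₁‖ ≤ r)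
    (hr : ‖h‖ ≤ r) (i : Fin P.m) :
    |P.Am.mulVec (finPart P.m (H.remainder b₁ h)) i|
      ≤ P.absAm.mulVec P.C1F i * r + P.absAm.mulVec P.C2F i * r ^ 2 := by
  refine (abs_mulVec_le P.Am (v := r • P.C1F + r ^ 2 • P.C2F) (fun j => ?_) i).trans_eq ?_
  · refine (H.abs_remainder_fin_le hL hb hr j).trans_eq ?_
    simp only [Pi.add_apply, Pi.smul_apply, smul_eq_mul]
    ring
  · rw [Matrix.mulVec_add, Matrix.mulVec_smul, Matrix.mulVec_smul, Pi.add_apply, Pi.smul_apply,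
      Pi.smul_apply, smul_eq_mul, smul_eq_mul, mul_comm r, mul_comm (r ^ 2)]
    rfl

variable (hL : 1 ≤ P.L) (hm : 6 ≤ P.m) {r : ℝ} {b₁ h : Omega P.s} (hb : ‖b₁‖ ≤ r) (hr : ‖h‖ ≤ r)
include hL hm hb hr

theorem abs_tailInv_remainder_le_greenSum (n : ℕ) :
    |P.tailInv (infPart P.m (H.remainder b₁ h)) n| ≤ P.η * (P.tailConst r / P.C₁
      * greenSum P.θ (fun j => 1 / wt (P.s + P.sL) (P.m + j)) n) :=
  H.abs_tailInv_le_greenSum (add_nonneg H.s_pos.le H.sL_nonneg)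
    (tailConst_nonneg H.one_lt_s hL hm ((norm_nonneg h).trans hr))
    (H.abs_remainder_tail_le hL hm hb hr) n

theorem abs_tailInv_remainder_le (n : ℕ) :
    |P.tailInv (infPart P.m (H.remainder b₁ h)) n|
      ≤ P.η * (P.tailConst r / P.C₁) * (1 / wt (P.s + P.sL) (P.m + n)
        * (geomWeight P.θ (P.s + P.sL) P.m n + P.θ / (1 - P.θ))) := by
  have hC := tailConst_nonneg H.one_lt_s hL hm ((norm_nonneg h).trans hr)
  refine (H.abs_tailInv_remainder_le_greenSum hL hm hb hr n).trans ?_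
  rw [← mul_assoc]
  exact mul_le_mul_of_nonneg_left
    (greenSum_one_div_wt_le H.θ_pos.le H.θ_lt_one (add_nonneg H.s_pos.le H.sL_nonneg)
      P.m_pos.ne' n)
    (mul_nonneg H.η_pos.le (div_nonneg hC H.C₁_pos.le))

theorem abs_tailInv_remainder_zero_le :
    |P.tailInv (infPart P.m (H.remainder b₁ h)) 0|
      ≤ P.η * (P.tailConst r / P.C₁) * (1 / (wt (P.s + P.sL) P.m * (1 - P.θ))) := by
  have hC := tailConst_nonneg H.one_lt_s hL hm ((norm_nonneg h).trans hr)
  refine (H.abs_tailInv_remainder_le_greenSum hL hm hb hr 0).trans ?_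
  rw [← mul_assoc]
  exact mul_le_mul_of_nonneg_left
    (greenSum_one_div_wt_zero_le H.θ_pos.le H.θ_lt_one (add_nonneg H.s_pos.le H.sL_nonneg)
      P.m_pos.ne')
    (mul_nonneg H.η_pos.le (div_nonneg hC H.C₁_pos.le))

end Regular

/-! ### The bound `Z` -/

/-- The entry of `Z(r)` of index `i < m`. -/
def ZF (P : Data) (r : ℝ) (i : Fin P.m) : ℝ :=
  P.Z1F r i + (P.DF P.C1F (seqNorm P.s P.xbar) i * r + P.DF P.C2F 1 i * r ^ 2)

/-- The entry of `Z(r)` of index `m + n` for `n ≤ M`. For `n > M` it is not the entry of `Z(r)`, but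
the estimates still hold with it. -/
def ZI (P : Data) (r : ℝ) (n : ℕ) : ℝ :=
  P.Z1I r n + (P.DI P.C1F (seqNorm P.s P.xbar) n * r + P.DI P.C2F 1 n * r ^ 2)

theorem Z_eq_glue (P : Data) (r : ℝ) : P.Z r = P.glue (P.ZF r) (P.ZI r) := by
  funext k
  unfold Z Z2 Z1 D1 D2 glue
  split_ifs
  · rfl
  · rfl
  · rw [ZI]
    ring

/-- The factor `X_n` of `D¹` and `D²`. -/
def tailWeight (P : Data) (n : ℕ) : ℝ :=
  if n < P.M then ∑ l ∈ Finset.Icc 0 n,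
      P.θ ^ (n - l) * (((P.m : ℝ) + n) / ((P.m : ℝ) + l)) ^ (P.s + P.sL)
    else P.χ

theorem tailWeight_of_le (P : Data) {n : ℕ} (hn : P.M ≤ n) : P.tailWeight n = P.χ :=
  if_neg hn.not_gt

/-- The factor of `θ^n` in `ZI`. -/
def geomConst (P : Data) (r : ℝ) : ℝ :=
  ((P.absDefect.mulVec P.WF P.last + P.ε * P.absAm P.last P.last) * r
    + (P.absAm.mulVec P.C1F P.last * r + P.absAm.mulVec P.C2F P.last * r ^ 2
      + |P.beta (P.m - 1) * P.Am P.last P.last|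
        * (P.η * (P.tailConst r / P.C₁) * (1 / (wt (P.s + P.sL) P.m * (1 - P.θ))))))
    * (P.η * (|P.lam P.m| / |P.mu P.m|))

theorem ZF_eq (P : Data) (r : ℝ) (i : Fin P.m) :
    P.ZF r i = (P.absDefect.mulVec P.WF i + P.ε * P.absAm i P.last) * r
      + ((P.absAm.mulVec P.C1F i * r + P.absAm.mulVec P.C2F i * r ^ 2)
        + |P.beta (P.m - 1)| * (P.η * (P.tailConst r / P.C₁) *
          (1 / (wt (P.s + P.sL) P.m * (1 - P.θ)))) * |P.Am i P.last|) := by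
  rw [ZF, Z1F, DF, DF, tailConst, show P.absAm i P.last = |P.Am i P.last| from rfl]
  generalize 1 - P.θ = d
  ring

theorem ZI_eq (P : Data) (r : ℝ) (n : ℕ) :
    P.ZI r n = P.geomConst r * P.θ ^ n + P.η * (P.tailConst r / P.C₁)
      * (1 / wt (P.s + P.sL) (P.m + n) * (P.tailWeight n + P.θ / (1 - P.θ))) := by
  rw [ZI, Z1I, DI, DI, geomConst, tailConst, abs_mul,
    show P.absAm P.last P.last = |P.Am P.last P.last| from rfl, tailWeight]
  generalize 1 - P.θ = d
  ring

theorem one_div_wt_add_le {t : ℝ} (ht : 0 ≤ t) (s : ℝ) {j k : ℕ} (hjk : j ≤ k) :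
    1 / wt (s + t) k ≤ 1 / wt (s + t) j * (wt s j / wt s k) := by
  have hsj := wt_pos s j
  have hsk := wt_pos s k
  have htj := wt_pos t j
  rw [wt_add, wt_add]
  calc 1 / (wt s k * wt t k) ≤ 1 / (wt s k * wt t j) := by
        gcongr
        exact wt_mono ht hjk
    _ = 1 / (wt s j * wt t j) * (wt s j / wt s k) := by field_simp

namespace Regular

variable (H : P.Regular C₂)
include H

theorem fderiv_newton_apply (b₁ h : Omega P.s) (k : ℕ) :
    fderiv ℝ H.newton (P.xbarOmega + b₁) h k
      = (h k - P.A (H.dagger h) k) - P.A (H.remainder b₁ h) k := by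
  rw [(H.hasFDerivAt_newton _).fderiv, ← H.ACLM_apply, ← H.ACLM_apply, remainder, map_sub]
  change h k - H.ACLM (H.fDeriv (P.xbarOmega + b₁) h) k
    = (h k - H.ACLM (H.dagger h) k) - (H.ACLM (H.fDeriv (P.xbarOmega + b₁) h) k
      - H.ACLM (H.dagger h) k)
  ring

theorem geomWeight_le_tailWeight (hm : 6 ≤ P.m) (hMA : P.CondMA) (n : ℕ) :
    geomWeight P.θ (P.s + P.sL) P.m n ≤ P.tailWeight n := by
  unfold tailWeight
  split_ifs with hn
  · rw [← Nat.range_succ_eq_Icc_zero]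
    exact le_rfl
  · exact H.geomWeight_le_χ (add_nonneg H.s_pos.le H.sL_nonneg) hm hMA (not_lt.1 hn)

theorem geomConst_nonneg (hL : 1 ≤ P.L) (hm : 6 ≤ P.m) {r : ℝ} (hr : 0 ≤ r) :
    0 ≤ P.geomConst r := by
  have hzero : ‖(0 : Omega P.s)‖ ≤ r := by rwa [norm_zero]
  have hdefect := (abs_nonneg _).trans (H.abs_defect_le hL hzero P.last)
  have hfin := (abs_nonneg _).trans (H.abs_mulVec_remainder_le hL hzero hzero P.last)
  have htail := (abs_nonneg _).trans (H.abs_tailInv_remainder_zero_le hL hm hzero hzero)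
  have hη := H.η_pos
  unfold geomConst
  positivity

theorem ZI_le_of_le (hL : 1 ≤ P.L) (hm : 6 ≤ P.m) (hMA : P.CondMA) (hMY : P.CondMY) {r : ℝ}
    (hr : 0 ≤ r) {n : ℕ} (hn : P.M ≤ n) :
    P.ZI r n ≤ P.ZI r P.M * (wt P.s (P.m + P.M) / wt P.s (P.m + n)) := by
  have hη := H.η_pos
  have hC₁ := H.C₁_pos
  have hC := tailConst_nonneg H.one_lt_s hL hm hr
  have hX : 0 ≤ P.χ + P.θ / (1 - P.θ) := by
    rw [← P.tailWeight_of_le le_rfl]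
    have hθ := H.θ_pos
    exact add_nonneg ((Finset.sum_nonneg fun _ _ => by positivity).trans
      (H.geomWeight_le_tailWeight hm hMA P.M)) (div_nonneg hθ.le H.one_sub_θ_pos.le)
  rw [ZI_eq, ZI_eq, P.tailWeight_of_le hn, P.tailWeight_of_le le_rfl, add_mul]
  refine add_le_add ?_ ?_
  · rw [mul_assoc, ← mul_div_assoc]
    exact mul_le_mul_of_nonneg_left (pow_le_pow_mul_wt_div_wt H.θ_pos H.s_pos.le P.m_pos.ne'
      (H.s_le hMY) hn) (H.geomConst_nonneg hL hm hr)
  · rw [mul_assoc _ _ (_ / _), mul_right_comm _ _ (_ / _)]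
    have hwt := one_div_wt_add_le H.sL_nonneg P.s (Nat.add_le_add_left hn P.m)
    gcongr

variable (hL : 1 ≤ P.L) (hm : 6 ≤ P.m) (hg : ∀ k, 2 * P.m - 1 ≤ k → P.g k = 0)
  {r : ℝ} {b₁ h : Omega P.s} (hb : ‖b₁‖ ≤ r) (hr : ‖h‖ ≤ r)
include hL hm hg hb hr

theorem abs_fderiv_newton_fin_le (i : Fin P.m) :
    |fderiv ℝ H.newton (P.xbarOmega + b₁) h i| ≤ P.ZF r i := by
  rw [fderiv_newton_apply, H.sub_A_dagger_fin hg, ZF_eq]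
  refine (abs_sub _ _).trans (add_le_add (H.abs_defect_le hL hr i)
    ((P.abs_A_fin_le _ i).trans (add_le_add (H.abs_mulVec_remainder_le hL hb hr i) ?_)))
  gcongr
  exact H.abs_tailInv_remainder_zero_le hL hm hb hr

theorem abs_fderiv_newton_tail_le (hMA : P.CondMA) (n : ℕ) :
    |fderiv ℝ H.newton (P.xbarOmega + b₁) h (P.m + n)| ≤ P.ZI r n := by
  have hη := H.η_pos
  have hθ := H.θ_pos
  have hC₁ := H.C₁_pos
  have hC := tailConst_nonneg H.one_lt_s hL hm ((norm_nonneg h).trans hr)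
  have hwt := wt_pos (P.s + P.sL) (P.m + n)
  have hdefect : |-(P.lam P.m * P.wI n * P.defect h P.last)|
      ≤ P.η * P.θ ^ n * (|P.lam P.m| / |P.mu P.m|)
        * ((P.absDefect.mulVec P.WF P.last + P.ε * P.absAm P.last P.last) * r) := by
    rw [abs_neg, abs_mul]
    exact mul_le_mul (H.abs_lam_mul_wI_le n) (H.abs_defect_le hL hr P.last) (abs_nonneg _)
      (by positivity)
  have hremainder : |P.A (H.remainder b₁ h) (P.m + n)|
      ≤ (P.absAm.mulVec P.C1F P.last * r + P.absAm.mulVec P.C2F P.last * r ^ 2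
        + |P.beta (P.m - 1) * P.Am P.last P.last| * (P.η * (P.tailConst r / P.C₁) *
          (1 / (wt (P.s + P.sL) P.m * (1 - P.θ)))))
          * (P.η * P.θ ^ n * (|P.lam P.m| / |P.mu P.m|))
        + P.η * (P.tailConst r / P.C₁) * (1 / wt (P.s + P.sL) (P.m + n)
          * (P.tailWeight n + P.θ / (1 - P.θ))) := by
    refine (H.abs_A_tail_le _ n).trans
      (add_le_add ?_ ((H.abs_tailInv_remainder_le hL hm hb hr n).trans ?_))
    · gcongr
      · exact H.abs_mulVec_remainder_le hL hb hr P.last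
      · exact H.abs_tailInv_remainder_zero_le hL hm hb hr
    · gcongr
      exact H.geomWeight_le_tailWeight hm hMA n
  rw [fderiv_newton_apply, H.sub_A_dagger_tail hg, ZI_eq, geomConst]
  refine (abs_sub _ _).trans ((add_le_add hdefect hremainder).trans_eq ?_)
  ring

theorem abs_fderiv_newton_le (hMA : P.CondMA) (hMY : P.CondMY) (k : ℕ) :
    |fderiv ℝ H.newton (P.xbarOmega + b₁) h k| ≤ P.Z r k := by
  rw [Z_eq_glue]
  refine P.glue_le_of_le (x := fun k => |fderiv ℝ H.newton (P.xbarOmega + b₁) h k|)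
    (H.abs_fderiv_newton_fin_le hL hm hg hb hr)
    (fun n _ => H.abs_fderiv_newton_tail_le hL hm hg hb hr hMA n) (fun n hn => ?_) k
  rw [mul_div_assoc]
  exact (H.abs_fderiv_newton_tail_le hL hm hg hb hr hMA n).trans
    (H.ZI_le_of_le hL hm hMA hMY ((norm_nonneg h).trans hr) hn.le)

end Regular

theorem regular_of_bounds {k₀ : ℕ} (hs : 1 < P.s) (hsL : 0 ≤ P.sL) (hC₁ : 0 < P.C₁)
    (hupper : ∀ k, |P.lam k / wt P.sL k| ≤ C₂ ∧ |P.mu k / wt P.sL k| ≤ C₂ ∧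
      |P.beta k / wt P.sL k| ≤ C₂)
    (hlower : ∀ k, k₀ ≤ k → P.C₁ ≤ |P.mu k / wt P.sL k|)
    (hδ : 0 < P.δ) (hδ' : P.δ < 1 / 2)
    (hratio : ∀ k, k₀ ≤ k → |P.lam k / P.mu k| ≤ P.δ ∧ |P.beta k / P.mu k| ≤ P.δ)
    (hmk : k₀ ≤ P.m) : P.Regular C₂ := by
  have habs_le : ∀ {c : ℝ} {k : ℕ}, |c / wt P.sL k| ≤ C₂ → |c| ≤ C₂ * wt P.sL k := fun h => by
    rwa [abs_div, abs_of_pos (wt_pos _ _), div_le_iff₀ (wt_pos _ _)] at h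
  have hmu : ∀ k, P.m ≤ k → P.C₁ * wt P.sL k ≤ |P.mu k| := fun k hk => by
    have h := hlower k (hmk.trans hk)
    rwa [abs_div, abs_of_pos (wt_pos _ _), le_div_iff₀ (wt_pos _ _)] at h
  have hmu_pos : ∀ k, P.m ≤ k → 0 < |P.mu k| := fun k hk =>
    (mul_pos hC₁ (wt_pos _ _)).trans_le (hmu k hk)
  have habs_le_mu : ∀ {c : ℝ} {k : ℕ}, P.m ≤ k → |c / P.mu k| ≤ P.δ → |c| ≤ P.δ * |P.mu k| :=
    fun hk h => by rwa [abs_div, div_le_iff₀ (hmu_pos _ hk)] at h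
  exact
    { one_lt_s := hs
      sL_nonneg := hsL
      C₁_pos := hC₁
      δ_pos := hδ
      δ_lt_half := hδ'
      mu_ne_zero := fun k hk => abs_pos.1 (hmu_pos k hk)
      abs_lam_le := fun k => habs_le (hupper k).1
      abs_mu_le := fun k => habs_le (hupper k).2.1
      abs_beta_le := fun k => habs_le (hupper k).2.2
      le_mu := hmu
      abs_lam_le_mu := fun k hk => habs_le_mu hk (hratio k (hmk.trans hk)).1
      abs_beta_le_mu := fun k hk => habs_le_mu hk (hratio k (hmk.trans hk)).2 }

end Data

end TridiagNewton

end

theorem mainTheorem1 (P : TridiagNewton.Data) (C₂ : ℝ) (k₀ : ℕ)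
    (hs : 1 < P.s) (hsL : 0 < P.sL)
    (hC₁ : 0 < P.C₁) (hC₁₂ : P.C₁ ≤ C₂)
    (hupper : ∀ k, |P.lam k / TridiagNewton.wt P.sL k| ≤ C₂ ∧
      |P.mu k / TridiagNewton.wt P.sL k| ≤ C₂ ∧ |P.beta k / TridiagNewton.wt P.sL k| ≤ C₂)
    (hlower : ∀ k, k₀ ≤ k → P.C₁ ≤ |P.mu k / TridiagNewton.wt P.sL k|)
    (hδ : 0 < P.δ) (hδ' : P.δ < 1 / 2)
    (hratio : ∀ k, k₀ ≤ k → |P.lam k / P.mu k| ≤ P.δ ∧ |P.beta k / P.mu k| ≤ P.δ)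
    (hg : ∀ k, 2 * P.m - 1 ≤ k → P.g k = 0)
    (hm : 6 ≤ P.m) (hmk : k₀ ≤ P.m)
    (hMA : P.CondMA) (hMY : P.CondMY) (hL : 1 ≤ P.L) :
    ∃ T : TridiagNewton.Omega P.s → TridiagNewton.Omega P.s,
      (∀ (x : TridiagNewton.Omega P.s) (k : ℕ), T x k = x k - P.A (P.f x) k) ∧
      Differentiable ℝ T ∧
      (∀ k, |(T P.xbarOmega - P.xbarOmega) k| ≤ P.Y k) ∧
      (∀ r : ℝ, 0 < r → ∀ b₁ b₂ : TridiagNewton.Omega P.s, ‖b₁‖ ≤ r → ‖b₂‖ ≤ r →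
        ∀ k, |fderiv ℝ T (P.xbarOmega + b₁) b₂ k| ≤ P.Z r k) := by
  have H := TridiagNewton.Data.regular_of_bounds hs hsL.le hC₁ hupper hlower hδ hδ' hratio hmk
  refine ⟨H.newton, H.newton_apply hg, fun x => (H.hasFDerivAt_newton x).differentiableAt,
    fun k => ?_, fun r _ b₁ b₂ hb₁ hb₂ k => H.abs_fderiv_newton_le hL hm hg hb₁ hb₂ hMA hMY k⟩
  rw [TridiagNewton.Omega.sub_apply, H.newton_apply hg, sub_sub_cancel_left, abs_neg]
  exact H.abs_A_f_xbar_le hg (by omega) H.s_pos.le hMA hMY k
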